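/- Let $\Bbbk$ be a field, $0\ne v\in\Bbbk$, $\delta=v+v^{-1}$, and let $[m]=\sum_{t=0}^{m-1}v^{m-1-2t}$, $[n]!=[1][2]\cdots[n]$. Let $\mathrm{TL}_n(\pm\delta)$ be the Temperley–Lieb algebra with parameter $\pm\delta$: generators $e_1,\dots,e_{n-1}$ and relations $e_i^2=\pm\delta e_i$, $e_ie_je_i=e_i$ if $|i-j|=1$, $e_ie_j=e_je_i$ if $|i-j|>1$. *Cell modules.* A link diagram on $n$ vertices is a planar diagram of links joining disjoint pairs of vertices, the remaining vertices being defects, none of which lies below a link. For a parameter $\epsilon\in\Bbbk$, the free $\Bbbk$-module $L_0$ on the link diagrams is a $\mathrm{TL}_n(\epsilon)$-module: $e_i$ acts by stacking its diagram above a link diagram and replacing each closed loop by the factor $\epsilon$. For a partition $\lambda=(\lambda_1,\lambda_2)$ of $n$ into at most two parts, put $d=\lambda_1-\lambda_2$ and $L(\lambda)=L_0^{\le d}/L_0^{<d}$, where $L_0^{\le d}$ (resp. $L_0^{<d}$) is the span of the link diagrams with at most (resp. fewer than) $d$ defects. *Tensor space.* Let $V$ have basis $y_1,y_{-1}$, let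 $Fy_1=y_{-1}$, $Fy_{-1}=0$, $K^{-1}y_{\pm1}=v^{\mp1}y_{\pm1}$, and let $F$ act on $V^{\otimes n}$ through $\Delta(F)=F\otimes K^{-1}+1\otimes F$. Make $V^{\otimes n}$ a $\mathrm{TL}_n(-\delta)$-module by letting $e_i$ act in the tensor positions $i,i+1$ by $y_{1}\otimes y_{1},\,y_{-1}\otimes y_{-1}\mapsto0$, $\ y_1\otimes y_{-1}\mapsto -v^{-1}y_1\otimes y_{-1}+y_{-1}\otimes y_1$, $\ y_{-1}\otimes y_1\mapsto y_1\otimes y_{-1}-v\,y_{-1}\otimes y_1$; it becomes a $\mathrm{TL}_n(\delta)$-module through the isomorphism $\mathrm{TL}_n(\delta)\cong\mathrm{TL}_n(-\delta)$, $e_i\mapsto-e_i$. For $b$ of weight $w$ put $\Phi_1(b)=b\otimes y_1$ and $\Phi_2(b)=[w]\,b\otimes y_{-1}-v^{w}Fb\otimes y_1$. Let $C(\lambda)\subseteq V^{\otimes n}$ be the $\Bbbk$-span of the vectors $\Upsilon_n\cdots\Upsilon_1(1)$ for all walks from $\emptyset$ to $\lambda$ on the Bratteli diagram of partitions with at most two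 parts, where $\Upsilon_i=\Phi_1$ (resp. $\Phi_2$) if the $i$-th step adds a box to the first (resp. second) row. For a link diagram $\ell$, which is in a unique way a juxtaposition of defects and of links with a defect-free link diagram $\ell'$ nested inside, let $N(\ell)\in V^{\otimes n}$ be the tensor product, in the given order, of a factor $y_1$ for each defect and a factor $y_1\otimes N(\ell')\otimes y_{-1}-v\,y_{-1}\otimes N(\ell')\otimes y_1$ for each such link, with $N(\emptyset)=1$. **Theorem.** Assume $[n]!\ne0$, and let $\lambda=(\lambda_1,\lambda_2)$ be a partition of $n$ into at most two parts. Then $C(\lambda)$ is a $\mathrm{TL}_n(-\delta)$-submodule and a $\mathrm{TL}_n(\delta)$-submodule of $V^{\otimes n}$. The rule $\ell\mapsto N(\ell)$, for link diagrams $\ell$ with $\lambda_1-\lambda_2$ defects, defines an isomorphism $L(\lambda)\cong C(\lambda)$ of $\mathrm{TL}_n(-\delta)$-modules, where $L(\lambda)$ is the cell module of $\mathrm{TL}_n(-\delta)$. Moreover $L(\lambda)\cong C(\lambda)$ as $\mathrm{TL}_n(\delta)$-modules, where $L(\lambda)$ is now the cell module of $\mathrm{TL}_n(\delta)$. -/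

import Mathlib

namespace TLCell

open scoped TensorProduct

/-! ### The Temperley--Lieb algebra by generators and relations -/

section Algebra

variable {k : Type*} [CommRing k]

/-- The defining relations of `TL_n(δ)`; the generator `e_{i+1}` has index `i : Fin (n - 1)`. -/
inductive TLRel (k : Type*) [CommRing k] (n : ℕ) (δ : k) :
    FreeAlgebra k (Fin (n - 1)) → FreeAlgebra k (Fin (n - 1)) → Prop
  | sq (i : Fin (n - 1)) :
      TLRel k n δ (FreeAlgebra.ι k i * FreeAlgebra.ι k i) (δ • FreeAlgebra.ι k i)
  | braid (i j : Fin (n - 1)) (h : (i : ℕ) + 1 = j ∨ (j : ℕ) + 1 = i) :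
      TLRel k n δ (FreeAlgebra.ι k i * FreeAlgebra.ι k j * FreeAlgebra.ι k i) (FreeAlgebra.ι k i)
  | comm (i j : Fin (n - 1)) (h : (i : ℕ) + 1 < j ∨ (j : ℕ) + 1 < i) :
      TLRel k n δ (FreeAlgebra.ι k i * FreeAlgebra.ι k j) (FreeAlgebra.ι k j * FreeAlgebra.ι k i)

/-- The Temperley--Lieb algebra `TL_n(δ)`. -/
def TL (k : Type*) [CommRing k] (n : ℕ) (δ : k) : Type _ := RingQuot (TLRel k n δ)

noncomputable instance (n : ℕ) (δ : k) : Ring (TL k n δ) :=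
  inferInstanceAs (Ring (RingQuot (TLRel k n δ)))

noncomputable instance (n : ℕ) (δ : k) : Algebra k (TL k n δ) :=
  inferInstanceAs (Algebra k (RingQuot (TLRel k n δ)))

/-- The projection from the free algebra. -/
noncomputable def TL.mk (n : ℕ) (δ : k) : FreeAlgebra k (Fin (n - 1)) →ₐ[k] TL k n δ :=
  RingQuot.mkAlgHom k (TLRel k n δ)

theorem TL.mk_rel {n : ℕ} {δ : k} {a b : FreeAlgebra k (Fin (n - 1))} (h : TLRel k n δ a b) :
    TL.mk n δ a = TL.mk n δ b :=
  RingQuot.mkAlgHom_rel k h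

theorem TL.mk_surjective (n : ℕ) (δ : k) : Function.Surjective (TL.mk n δ) :=
  RingQuot.mkAlgHom_surjective k (TLRel k n δ)

/-- The generators of `TL_n(δ)`. -/
noncomputable def TL.e {n : ℕ} (δ : k) (i : Fin (n - 1)) : TL k n δ :=
  TL.mk n δ (FreeAlgebra.ι k i)

theorem TL.e_sq {n : ℕ} (δ : k) (i : Fin (n - 1)) : TL.e δ i * TL.e δ i = δ • TL.e δ i := by
  simpa only [map_mul, map_smul, TL.e] using TL.mk_rel (TLRel.sq (k := k) (δ := δ) i)

theorem TL.e_braid {n : ℕ} (δ : k) (i j : Fin (n - 1))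
    (h : (i : ℕ) + 1 = j ∨ (j : ℕ) + 1 = i) : TL.e δ i * TL.e δ j * TL.e δ i = TL.e δ i := by
  simpa only [map_mul, map_smul, TL.e] using TL.mk_rel (TLRel.braid (k := k) (δ := δ) i j h)

theorem TL.e_comm {n : ℕ} (δ : k) (i j : Fin (n - 1))
    (h : (i : ℕ) + 1 < j ∨ (j : ℕ) + 1 < i) : TL.e δ i * TL.e δ j = TL.e δ j * TL.e δ i := by
  simpa only [map_mul, map_smul, TL.e] using TL.mk_rel (TLRel.comm (k := k) (δ := δ) i j h)

/-- The universal property of `TL_n(δ)`. -/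
noncomputable def TL.lift {n : ℕ} (δ : k) {A : Type*} [Ring A] [Algebra k A]
    (f : Fin (n - 1) → A)
    (h1 : ∀ i, f i * f i = δ • f i)
    (h2 : ∀ i j : Fin (n - 1), (i : ℕ) + 1 = j ∨ (j : ℕ) + 1 = i → f i * f j * f i = f i)
    (h3 : ∀ i j : Fin (n - 1), (i : ℕ) + 1 < j ∨ (j : ℕ) + 1 < i → f i * f j = f j * f i) :
    TL k n δ →ₐ[k] A :=
  RingQuot.liftAlgHom k ⟨FreeAlgebra.lift k f, by
    intro x y hxy
    cases hxy with
    | sq i => simpa using h1 i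
    | braid i j h => simpa using h2 i j h
    | comm i j h => simpa using h3 i j h⟩

theorem TL.lift_e {n : ℕ} (δ : k) {A : Type*} [Ring A] [Algebra k A]
    (f : Fin (n - 1) → A) (h1 h2 h3) (i : Fin (n - 1)) :
    TL.lift δ f h1 h2 h3 (TL.e δ i) = f i :=
  (RingQuot.liftAlgHom_mkAlgHom_apply k _ _ _).trans (by simp)

/-- The homomorphism `TL_n(δ) → TL_n(-δ)` with `e_i ↦ -e_i` (it is an isomorphism, its inverse
being given by the same rule). -/
noncomputable def TL.signChange (n : ℕ) (δ : k) : TL k n δ →ₐ[k] TL k n (-δ) :=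
  TL.lift δ (fun i => -TL.e (-δ) i)
    (by intro i; rw [neg_mul_neg, TL.e_sq, neg_smul, smul_neg])
    (by intro i j h; rw [neg_mul_neg, mul_neg, TL.e_braid (-δ) i j h])
    (by intro i j h; rw [neg_mul_neg, neg_mul_neg, TL.e_comm (-δ) i j h])

/-- A `k`-subspace stable under the generators is stable under the algebra. -/
theorem TL.apply_mem {n : ℕ} {δ : k} {M : Type*} [AddCommGroup M] [Module k M]
    (ρ : TL k n δ →ₐ[k] Module.End k M) (S : Submodule k M)
    (h : ∀ i, ∀ m ∈ S, ρ (TL.e δ i) m ∈ S) (x : TL k n δ) {m : M} (hm : m ∈ S) :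
    ρ x m ∈ S := by
  obtain ⟨a, rfl⟩ := TL.mk_surjective n δ x
  induction a using FreeAlgebra.induction generalizing m with
  | grade0 r =>
    rw [AlgHom.commutes, AlgHom.commutes]
    simpa [Module.algebraMap_end_apply] using S.smul_mem r hm
  | grade1 i => exact h i m hm
  | mul a b ha hb => 
    rw [map_mul, map_mul]
    exact ha (hb hm)
  | add a b ha hb =>
    rw [map_add, map_add]
    exact S.add_mem (ha hm) (hb hm)

end Algebra

/-! ### Link diagrams -/

/-- A link diagram on the `n` vertices `0, …, n - 1`, in a row: `partner x` is the vertex linked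
to `x`, and `partner x = x` if the vertex `x` is a defect. (To have functions on `ℕ` we put
`partner x = x` also for `x ≥ n`.) Links do not cross, and no defect lies below a link. -/
@[ext]
structure LinkDiagram (n : ℕ) where
  partner : ℕ → ℕ
  partner_of_le : ∀ x, n ≤ x → partner x = x
  invol : ∀ x, partner (partner x) = x
  planar : ∀ x y, x < y → y < partner x → x < partner y ∧ partner y < partner x ∧ partner y ≠ y

namespace LinkDiagram

variable {n : ℕ}

/-- The number of defects. -/
def defects (l : LinkDiagram n) : ℕ := ((Finset.range n).filter fun x => l.partner x = x).card

theorem partner_lt (l : LinkDiagram n) {x : ℕ} (h : x < n) : l.partner x < n := by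
  by_contra h'
  have := l.partner_of_le (l.partner x) (by omega)
  rw [l.invol] at this
  omega

theorem partner_eq_iff (l : LinkDiagram n) {a b : ℕ} : l.partner a = b ↔ a = l.partner b :=
  ⟨fun h => by rw [← h, l.invol], fun h => by rw [h, l.invol]⟩

/-- The partner function of the link diagram obtained by stacking the diagram of `e` (which links
`i` to `i + 1` in both rows, and joins each other vertex to the one below it) above the link
diagram with partner function `p`. A vertex whose line ends at `i` or `i + 1` in the upper row of
`p` continues through the lower link of `e` at the other one of the two. -/
def stackFun (i : ℕ) (p : ℕ → ℕ) (x : ℕ) : ℕ :=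
  if x = i then i + 1
  else if x = i + 1 then i
  else if p x = i then (if p (i + 1) = i + 1 then x else p (i + 1))
  else if p x = i + 1 then (if p i = i then x else p i)
  else p x

/-- The diagram of the generator `e`, linking `i` to `i + 1`, stacked above `l`, with a loop
removed if there is one. -/
def stack (i : Fin (n - 1)) (l : LinkDiagram n) : LinkDiagram n where
  partner := stackFun i l.partner
  partner_of_le x hx := by
    have := l.partner_of_le x hx
    have hi := i.2
    simp only [stackFun]
    grind
  invol x := by
    have h0 := l.invol
    have := l.invol x
    have := l.invol i
    have := l.invol (i + 1)
    simp only [stackFun]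
    grind
  planar x y hxy hy := by
    have h0 := l.invol
    have h1 := l.planar
    simp only [stackFun] at *
    have hx := l.invol x
    have hy' := l.invol y
    have hi := l.invol i
    have hj := l.invol (i + 1)
    have e1 : l.partner x = i → x = l.partner i := fun h => (l.partner_eq_iff.1 h)
    have e2 : l.partner x = i + 1 → x = l.partner (i + 1) := fun h => (l.partner_eq_iff.1 h)
    have e3 : l.partner y = i → y = l.partner i := fun h => (l.partner_eq_iff.1 h)
    have e4 : l.partner y = i + 1 → y = l.partner (i + 1) := fun h => (l.partner_eq_iff.1 h)
    have e5 : l.partner i = i + 1 → l.partner (i + 1) = i := fun h => (l.partner_eq_iff.1 h).symm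
    have e6 : l.partner (i + 1) = i → l.partner i = i + 1 := fun h => (l.partner_eq_iff.1 h).symm
    have f1 := l.planar x y
    have f2 := l.planar x i
    have f3 := l.planar x (i + 1)
    have f4 := l.planar y i
    have f5 := l.planar y (i + 1)
    have f6 := l.planar i x
    have f7 := l.planar i y
    have f8 := l.planar i (i + 1)
    have f9 := l.planar (i + 1) x
    have f10 := l.planar (i + 1) y
    have f11 := l.planar (l.partner i) x
    have f12 := l.planar (l.partner i) y
    have f13 := l.planar (l.partner i) (i + 1)
    have f14 := l.planar (l.partner (i + 1)) x
    have f15 := l.planar (l.partner (i + 1)) y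
    have f16 := l.planar (l.partner (i + 1)) i
    have g1 := l.planar i (l.partner y)
    have g2 := l.planar (i + 1) (l.partner y)
    have g3 := l.planar (l.partner i) (l.partner y)
    have g4 := l.planar (l.partner (i + 1)) (l.partner y)
    have g5 := l.planar x (l.partner y)
    have g6 : l.partner x = y ↔ x = l.partner y := l.partner_eq_iff
    have g7 : l.partner i = x ↔ i = l.partner x := l.partner_eq_iff
    have g8 : l.partner (i + 1) = x ↔ i + 1 = l.partner x := l.partner_eq_iff
    have g9 : l.partner i = y ↔ i = l.partner y := l.partner_eq_iff
    have g10 : l.partner (i + 1) = y ↔ i + 1 = l.partner y := l.partner_eq_iff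
    have i1 : l.partner y = l.partner i → y = i := fun h => by rw [← hy', h, hi]
    have i2 : l.partner y = l.partner (i + 1) → y = i + 1 := fun h => by rw [← hy', h, hj]
    have i3 : l.partner x = l.partner i → x = i := fun h => by rw [← hx, h, hi]
    have i4 : l.partner x = l.partner (i + 1) → x = i + 1 := fun h => by rw [← hx, h, hj]
    rw [hy'] at g1 g2 g3 g4 g5
    rw [hi] at g3
    rw [hj] at g4
    rw [hi] at f11 f12 f13
    rw [hj] at f14 f15 f16
    clear h0 h1
    generalize l.partner x = px at *
    generalize l.partner y = py at *
    generalize l.partner i = pi at *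
    generalize l.partner (i + 1) = pj at *
    generalize (i : ℕ) = a at *
    clear hx hy' hi hj
    split_ifs at hy ⊢ <;> grind (splits := 40)

theorem stack_self (i : Fin (n - 1)) (l : LinkDiagram n) : (stack i l).partner i = i + 1 := by
  simp [stack, stackFun]

theorem stack_stack_self (i : Fin (n - 1)) (l : LinkDiagram n) :
    stack i (stack i l) = stack i l := by
  ext x
  simp only [stack, stackFun]
  have := l.invol x
  grind

theorem stack_braid (i j : Fin (n - 1)) (h : (i : ℕ) + 1 = j ∨ (j : ℕ) + 1 = i)
    (l : LinkDiagram n) : stack i (stack j (stack i l)) = stack i l := by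
  ext x
  have := l.invol x
  have := l.invol i
  have := l.invol (i + 1)
  have := l.invol j
  have := l.invol (j + 1)
  obtain h | h := h
  · simp only [stack, stackFun, ← h] at *
    generalize (i : ℕ) = a at *
    grind (splits := 30)
  · simp only [stack, stackFun, ← h] at *
    generalize (j : ℕ) = a at *
    grind (splits := 30)

theorem stack_comm (i j : Fin (n - 1)) (h : (i : ℕ) + 1 < j ∨ (j : ℕ) + 1 < i)
    (l : LinkDiagram n) : stack i (stack j l) = stack j (stack i l) := by
  ext x
  have := l.invol x
  have := l.invol i
  have := l.invol (i + 1)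
  have := l.invol j
  have := l.invol (j + 1)
  simp only [stack, stackFun]
  generalize (i : ℕ) = a at *
  generalize (j : ℕ) = b at *
  grind (splits := 30)

variable {k : Type*} [CommRing k]

/-- The scalar `δ ^ N` where `N` is the number of loops removed when the diagram of the generator
`e`, linking `i` to `i + 1`, is stacked above `l`: there is one such loop if `l` links `i` to
`i + 1`, and none otherwise. -/
def loopFactor (δ : k) (i : Fin (n - 1)) (l : LinkDiagram n) : k :=
  if l.partner i = i + 1 then δ else 1

theorem loopFactor_comm (δ : k) (i j : Fin (n - 1)) (h : (i : ℕ) + 1 < j ∨ (j : ℕ) + 1 < i)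
    (l : LinkDiagram n) : loopFactor δ j l * loopFactor δ i (stack j l)
      = loopFactor δ i l * loopFactor δ j (stack i l) := by
  obtain ⟨a, ha⟩ := i
  obtain ⟨b, hb⟩ := j
  have := l.invol a
  have := l.invol (a + 1)
  have := l.invol b
  have := l.invol (b + 1)
  simp only [stack, stackFun, loopFactor] at *
  grind (splits := 30)

theorem defects_stack_le (i : Fin (n - 1)) (l : LinkDiagram n) :
    (stack i l).defects ≤ l.defects := by
  have hi := i.2
  refine Finset.card_le_card_of_injOn
    (fun x => if l.partner x = i then i + 1 else if l.partner x = i + 1 then i else x) ?_ ?_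
  · intro x hx
    simp only [stack, stackFun, Finset.coe_filter, Finset.mem_range, Set.mem_ofPred_eq] at hx ⊢
    have := l.invol x
    have := l.invol i
    have := l.invol (i + 1)
    grind
  · intro x hx y hy hxy
    simp only [stack, stackFun] at hx hy
    simp only at hxy
    have := l.invol x
    have := l.invol y
    have := l.invol i
    have := l.invol (i + 1)
    grind

end LinkDiagram

/-! ### The module of link diagrams and the cell modules -/

section Cell

open LinkDiagram

variable {k : Type*} [CommRing k]

/-- The free `k`-module `L₀` on the link diagrams on `n` vertices. -/
def L0 (k : Type*) [CommRing k] (n : ℕ) : Type _ := LinkDiagram n →₀ k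

noncomputable instance (n : ℕ) : AddCommGroup (L0 k n) :=
  inferInstanceAs (AddCommGroup (LinkDiagram n →₀ k))

noncomputable instance (n : ℕ) : Module k (L0 k n) :=
  inferInstanceAs (Module k (LinkDiagram n →₀ k))

/-- The basis of `L₀` given by the link diagrams. -/
noncomputable def L0.basis (k : Type*) [CommRing k] (n : ℕ) :
    Module.Basis (LinkDiagram n) k (L0 k n) :=
  Module.Basis.ofRepr (LinearEquiv.refl k (LinkDiagram n →₀ k))

/-- The action of the generator `e` linking `i` to `i + 1`, for the loop parameter `δ`. -/
noncomputable def L0.gen {n : ℕ} (δ : k) (i : Fin (n - 1)) : Module.End k (L0 k n) :=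
  (L0.basis k n).constr k fun l => loopFactor δ i l • L0.basis k n (stack i l)

theorem L0.gen_basis {n : ℕ} (δ : k) (i : Fin (n - 1)) (l : LinkDiagram n) :
    L0.gen δ i (L0.basis k n l) = loopFactor δ i l • L0.basis k n (stack i l) := by
  simp [L0.gen]

/-- The representation of `TL_n(δ)` on `L₀` by diagram multiplication. -/
noncomputable def L0.rep (n : ℕ) (δ : k) : TL k n δ →ₐ[k] Module.End k (L0 k n) :=
  TL.lift δ (L0.gen δ)
    (by
      intro i
      refine (L0.basis k n).ext fun l => ?_
      rw [Module.End.mul_apply, LinearMap.smul_apply, L0.gen_basis, map_smul, L0.gen_basis,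
        stack_stack_self, smul_comm]
      simp [loopFactor, stack_self])
    (by
      intro i j h
      refine (L0.basis k n).ext fun l => ?_
      have h1 : ¬ (stack i l).partner j = j + 1 := by
        have := (stack i l).invol i
        have := (stack i l).invol j
        have := stack_self i l
        grind
      have h2 : ¬ (stack j (stack i l)).partner i = i + 1 := by
        have := (stack j (stack i l)).invol j
        have := (stack j (stack i l)).invol i
        have := stack_self j (stack i l)
        grind
      rw [Module.End.mul_apply, Module.End.mul_apply, L0.gen_basis, map_smul, map_smul,
        L0.gen_basis, map_smul, L0.gen_basis, stack_braid i j h]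
      simp [loopFactor, h1, h2])
    (by
      intro i j h
      refine (L0.basis k n).ext fun l => ?_
      simp only [L0.gen_basis, Module.End.mul_apply, map_smul, smul_smul, stack_comm i j h,
        loopFactor_comm δ i j h])

noncomputable instance (n : ℕ) (δ : k) : Module (TL k n δ) (L0 k n) :=
  Module.compHom (L0 k n) (L0.rep n δ).toRingHom

theorem L0.smul_def {n : ℕ} {δ : k} (x : TL k n δ) (m : L0 k n) : x • m = L0.rep n δ x m := rfl

/-- `e_i` acts on link diagrams by stacking and removing loops. -/
theorem L0.e_smul_basis {n : ℕ} (δ : k) (i : Fin (n - 1)) (l : LinkDiagram n) :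
    TL.e δ i • L0.basis k n l = loopFactor δ i l • L0.basis k n (stack i l) := by
  rw [L0.smul_def, L0.rep, TL.lift_e, L0.gen_basis]

instance (n : ℕ) (δ : k) : IsScalarTower k (TL k n δ) (L0 k n) where
  smul_assoc a x m := by simp [L0.smul_def]

/-- The `k`-span of the link diagrams satisfying `P`, where `P` is inherited by `stack i l`. -/
noncomputable def L0.spanOf {n : ℕ} (δ : k) (P : LinkDiagram n → Prop)
    (hP : ∀ i l, P l → P (stack i l)) : Submodule (TL k n δ) (L0 k n) where
  toAddSubmonoid := (Submodule.span k (L0.basis k n '' {l | P l})).toAddSubmonoid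
  smul_mem' x m hm := by
    refine TL.apply_mem (L0.rep n δ) (Submodule.span k (L0.basis k n '' {l | P l})) ?_ x hm
    intro i m hm
    induction hm using Submodule.span_induction with
    | mem m h =>
      obtain ⟨l, hl, rfl⟩ := h
      rw [L0.rep, TL.lift_e, L0.gen_basis]
      exact Submodule.smul_mem _ _ (Submodule.subset_span ⟨_, hP i l hl, rfl⟩)
    | zero => simp
    | add a b _ _ ha hb => rw [map_add]; exact Submodule.add_mem _ ha hb
    | smul c a _ ha => rw [map_smul]; exact Submodule.smul_mem _ _ ha

/-- `L₀^{≤ d}`, spanned by the link diagrams with at most `d` defects. -/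
noncomputable def L0.le (n : ℕ) (δ : k) (d : ℕ) : Submodule (TL k n δ) (L0 k n) :=
  L0.spanOf δ (fun l => l.defects ≤ d) fun i l h => (defects_stack_le i l).trans h

/-- `L₀^{< d}`, spanned by the link diagrams with fewer than `d` defects. -/
noncomputable def L0.lt (n : ℕ) (δ : k) (d : ℕ) : Submodule (TL k n δ) (L0 k n) :=
  L0.spanOf δ (fun l => l.defects < d) fun i l h => (defects_stack_le i l).trans_lt h

/-- The cell module `L(d) = L₀^{≤ d} / L₀^{< d}` of `TL_n(δ)`. -/
abbrev CellModule (n : ℕ) (δ : k) (d : ℕ) : Type _ :=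
  L0.le n δ d ⧸ (L0.lt n δ d).comap (L0.le n δ d).subtype

/-- The class in `L(d)` of a link diagram with at most `d` defects. -/
noncomputable def CellModule.cls {n : ℕ} (δ : k) {d : ℕ} (l : LinkDiagram n) (h : l.defects ≤ d) :
    CellModule n δ d :=
  Submodule.Quotient.mk ⟨L0.basis k n l, Submodule.subset_span (Set.mem_image_of_mem _ h)⟩

end Cell

/-! ### Link diagrams as juxtapositions of nestings and segments -/

/-- `Nesting n d` is the type of the link diagrams with `n` vertices and `d` defects as they are
built by juxtaposing, from left to right, segments (defects) and nestings of a link diagram without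
defects within a link. -/
inductive Nesting : ℕ → ℕ → Type
  /-- the empty diagram -/
  | empty : Nesting 0 0
  /-- `t` followed by a segment -/
  | defect {n d : ℕ} (t : Nesting n d) : Nesting (n + 1) (d + 1)
  /-- `t` followed by a link within which the diagram `b` without defects is nested -/
  | link {n d m : ℕ} (t : Nesting n d) (b : Nesting m 0) : Nesting (n + (1 + m + 1)) d

namespace Nesting

/-- The links of the diagram, as a partner function. -/
def partner : {n d : ℕ} → Nesting n d → ℕ → ℕ
  | _, _, empty => id
  | _, _, defect t => t.partner
  | _, _, @link n _ m t b => fun x =>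
      if x < n then t.partner x
      else if x = n then n + 1 + m
      else if x = n + 1 + m then n
      else if x < n + 1 + m then n + 1 + b.partner (x - (n + 1))
      else x

theorem partner_of_le {n d : ℕ} (t : Nesting n d) : ∀ x, n ≤ x → t.partner x = x := by
  induction t with
  | empty => intro x _; rfl
  | defect t ih => intro x hx; exact ih x (by omega)
  | @link n d m t b iht ihb =>
    intro x hx
    simp only [partner]
    grind

theorem partner_lt {n d : ℕ} (t : Nesting n d) : ∀ x, x < n → t.partner x < n := by
  induction t with
  | empty => intro x h; omega
  | @defect n d t ih =>
    intro x hx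
    have := ih x
    have := t.partner_of_le x
    simp only [partner]
    grind
  | @link n d m t b iht ihb =>
    intro x hx
    have := iht x
    have := ihb (x - (n + 1))
    simp only [partner]
    grind

theorem eq_zero_of_forall_ne {n d : ℕ} (t : Nesting n d) (h : ∀ x, x < n → t.partner x ≠ x) :
    d = 0 := by
  induction t with
  | empty => rfl
  | @defect n d t ih => exact absurd (t.partner_of_le n le_rfl) (h n (by omega))
  | @link n d m t b iht ihb =>
    refine iht fun x hx => ?_
    have := h x (by omega)
    simp only [partner, if_pos hx] at this
    exact this

theorem exists_partner (N : ℕ) : ∀ p : ℕ → ℕ, (∀ x, N ≤ x → p x = x) → (∀ x, p (p x) = x) →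
    (∀ x y, x < y → y < p x → x < p y ∧ p y < p x ∧ p y ≠ y) →
    ∃ (d : ℕ) (t : Nesting N d), t.partner = p := by
  induction N using Nat.strong_induction_on with
  | _ N ih =>
    intro p h1 h2 h3
    rcases Nat.eq_zero_or_pos N with rfl | hN
    · exact ⟨0, empty, funext fun x => (h1 x (Nat.zero_le x)).symm⟩
    obtain ⟨M, rfl⟩ : ∃ M, N = M + 1 := ⟨N - 1, by omega⟩
    have hlt : ∀ x, x < M + 1 → p x < M + 1 := by
      intro x hx
      by_contra h
      have := h1 (p x) (by omega)
      rw [h2] at this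
      omega
    by_cases hM : p M = M
    · obtain ⟨d, t, ht⟩ := ih M (by omega) p
        (fun x hx => by
          rcases Nat.eq_or_lt_of_le hx with rfl | hx
          · exact hM
          · exact h1 x hx) h2 h3
      exact ⟨d + 1, defect t, ht⟩
    obtain ⟨n, hn⟩ : ∃ n, p M = n := ⟨_, rfl⟩
    have hnM : p n = M := by rw [← hn, h2]
    have hlt' := hlt M (by omega)
    obtain ⟨m, hm⟩ : ∃ m, M = n + 1 + m := ⟨M - (n + 1), by omega⟩
    have hinj : ∀ x y, p x = p y → x = y := fun x y h => by rw [← h2 x, h, h2]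
    have hin : ∀ x, n < x → x < M → n < p x ∧ p x < M ∧ p x ≠ x := fun x hx hx' => by
      have := h3 n x hx (by omega)
      rwa [hnM] at this
    have hout : ∀ x, x < n → p x < n := by
      intro x hx
      have a1 := hlt x (by omega)
      have a2 : p x ≠ n := fun h => by
        have := hinj x M (by omega)
        omega
      have a3 : p x ≠ M := fun h => by
        have := hinj x n (by omega)
        omega
      by_contra h
      have := hin (p x) (by omega) (by omega)
      rw [h2] at this
      omega
    obtain ⟨d, t, ht⟩ := ih n (by omega) (fun x => if x < n then p x else x)
      (fun x hx => by simp [not_lt.2 hx])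
      (fun x => by
        have := hout x
        have := h2 x
        grind)
      (fun x y hxy hy => by
        have := hout x
        have := hout y
        have := h3 x y hxy
        grind)
    have hb : ∀ y, y < m → ∃ z, z < m ∧ p (n + 1 + y) = n + 1 + z ∧ z ≠ y := fun y hy => by
      have := hin (n + 1 + y) (by omega) (by omega)
      exact ⟨p (n + 1 + y) - (n + 1), by omega, by omega, by omega⟩
    obtain ⟨d', b, hb'⟩ := ih m (by omega) (fun y => if y < m then p (n + 1 + y) - (n + 1) else y)
      (fun x hx => by simp [not_lt.2 hx])
      (fun x => by
        by_cases hx : x < m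
        · obtain ⟨z, hz, hz', -⟩ := hb x hx
          have := h2 (n + 1 + x)
          rw [hz'] at this
          simp only [hx, if_true, hz', Nat.add_sub_cancel_left, hz, this]
        · simp [hx])
      (fun x y hxy hy => by
        by_cases hx : x < m
        · obtain ⟨z, hz, hz', hz''⟩ := hb x hx
          simp only [hx, if_true, hz', Nat.add_sub_cancel_left] at hy ⊢
          have hym : y < m := by omega
          obtain ⟨w, hw, hw', hw''⟩ := hb y hym
          simp only [hym, if_true, hw', Nat.add_sub_cancel_left]
          have := h3 (n + 1 + x) (n + 1 + y) (by omega) (by omega)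
          omega
        · simp only [hx, if_false] at hy
          omega)
    obtain rfl : d' = 0 := b.eq_zero_of_forall_ne fun y hy => by
      obtain ⟨z, hz, hz', hz''⟩ := hb y hy
      simp only [hb', hy, if_true, hz', Nat.add_sub_cancel_left]
      exact hz''
    have hMN : M + 1 = n + (1 + m + 1) := by omega
    have key : (link t b).partner = p := by
      funext x
      simp only [partner, ht, hb']
      by_cases c1 : x < n
      · simp [c1]
      by_cases c2 : x = n
      · subst c2; simp [hnM]; omega
      by_cases c3 : x = n + 1 + m
      · rw [if_neg c1, if_neg c2, if_pos c3, c3, ← hm, hn]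
      by_cases c4 : x < n + 1 + m
      · obtain ⟨z, hz, hz', -⟩ := hb (x - (n + 1)) (by omega)
        have e : n + 1 + (x - (n + 1)) = x := by omega
        have e' : x - (n + 1) < m := by omega
        rw [e] at hz'
        simp [c1, c2, c3, c4, e, e', hz']
      · have := h1 x (by omega)
        simp [c1, c2, c3, c4, this]
    rw [hMN]
    exact ⟨d, link t b, key⟩

theorem partner_injective {n d : ℕ} (s : Nesting n d) : ∀ {n' d' : ℕ} (t : Nesting n' d'), n = n' →
    s.partner = t.partner → (⟨n, d, s⟩ : Σ n d, Nesting n d) = ⟨n', d', t⟩ := by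
  induction s with
  | empty =>
    intro n' d' t hn _
    cases t with
    | empty => rfl
    | defect t => omega
    | link t b => omega
  | @defect n d s ih =>
    intro n' d' t hn h
    cases t with
    | empty => omega
    | @defect n' d' t =>
      have := ih t (by omega) h
      cases this
      rfl
    | @link n' d' m t b =>
      have h1 := congrFun h n
      have h2 := s.partner_of_le n le_rfl
      simp only [partner] at h1
      grind
  | @link n d m s c ihs ihc =>
    intro n' d' t hn h
    cases t with
    | empty => omega
    | @defect n' d' t =>
      have h1 := congrFun h n'
      have h2 := t.partner_of_le n' le_rfl
      simp only [partner] at h1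
      grind
    | @link n' d' m' t b =>
      have h1 := congrFun h (n + 1 + m)
      simp only [partner] at h1
      obtain rfl : n = n' := by grind
      obtain rfl : m = m' := by omega
      have hs := ihs t rfl (by
        funext x
        by_cases hx : x < n
        · have := congrFun h x
          simpa [partner, hx] using this
        · rw [s.partner_of_le x (by omega), t.partner_of_le x (by omega)])
      have hc := ihc b rfl (by
        funext x
        by_cases hx : x < m
        · have := congrFun h (n + 1 + x)
          have a1 : ¬ n + 1 + x < n := by omega
          have a2 : ¬ n + 1 + x = n := by omega
          have a3 : ¬ x = m := by omega
          simpa [partner, hx, a1, a2, a3] using this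
        · rw [c.partner_of_le x (by omega), b.partner_of_le x (by omega)])
      cases hs
      cases hc
      rfl

end Nesting

/-- Every link diagram is built in exactly one way by juxtaposing segments and nestings. -/
theorem LinkDiagram.existsUnique_nesting {n : ℕ} (l : LinkDiagram n) :
    ∃! t : (Σ d, Nesting n d), t.2.partner = l.partner := by
  obtain ⟨d, t, ht⟩ := Nesting.exists_partner n l.partner l.partner_of_le l.invol l.planar
  refine ⟨⟨d, t⟩, ht, ?_⟩
  rintro ⟨d', t'⟩ ht'
  have := Nesting.partner_injective t' t rfl (ht'.trans ht.symm)
  cases this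
  rfl

/-- The construction of a link diagram from segments and nestings. -/
noncomputable def LinkDiagram.nesting {n : ℕ} (l : LinkDiagram n) : Σ d, Nesting n d :=
  l.existsUnique_nesting.choose

/-! ### Tensor space -/

section Tensor

variable {k : Type*} [Field k]

/-- The two-dimensional space `V` with basis `y_1` (index `true`) and `y_{-1}` (index `false`). -/
abbrev V (k : Type*) [Field k] : Type _ := Bool → k

/-- The basis vectors `y_1 = yVec true` and `y_{-1} = yVec false` of `V`. -/
def yVec (s : Bool) : V k := Pi.single s 1

/-- The basis of `V^{⊗n}` consisting of the tensors `y_{γ_1} ⊗ ⋯ ⊗ y_{γ_n}`. -/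
noncomputable def tensorBasis (k : Type*) [Field k] (n : ℕ) :
    Module.Basis (Fin n → Bool) k (⨂[k]^n (V k)) :=
  Basis.piTensorProduct fun _ => Pi.basisFun k Bool

theorem tensorBasis_apply (n : ℕ) (γ : Fin n → Bool) :
    tensorBasis k n γ = PiTensorProduct.tprod k fun j => yVec (γ j) := by
  simp [tensorBasis, yVec]

/-- The tensor product `V^{⊗n} × V^{⊗m} → V^{⊗(n+m)}`. -/
noncomputable def tmul {n m : ℕ} (a : ⨂[k]^n (V k)) (b : ⨂[k]^m (V k)) : ⨂[k]^(n + m) (V k) :=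
  TensorPower.mulEquiv (a ⊗ₜ[k] b)

/-- The vector `1` of `V^{⊗0} = k`. -/
noncomputable def tone : ⨂[k]^0 (V k) := PiTensorProduct.tprod k Fin.elim0

/-- `y_1` (for `true`) and `y_{-1}` (for `false`) in `V^{⊗1} = V`. -/
noncomputable def ty (s : Bool) : ⨂[k]^1 (V k) := PiTensorProduct.tprod k fun _ => yVec s

/-- The action of `F` on `V`: `F y_1 = y_{-1}` and `F y_{-1} = 0`. -/
noncomputable def FV (k : Type*) [Field k] : Module.End k (V k) :=
  (Pi.basisFun k Bool).constr k fun s => if s then yVec false else 0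

/-- The action of `K⁻¹` on `V`: `K⁻¹ y_1 = v⁻¹ y_1` and `K⁻¹ y_{-1} = v y_{-1}`. -/
noncomputable def KinvV (v : k) : Module.End k (V k) :=
  (Pi.basisFun k Bool).constr k fun s => (if s then v⁻¹ else v) • yVec s

/-- The action of `F` on `V^{⊗n}`, given by `F = 0` on `V^{⊗0}` and by the comultiplication
`Δ(F) = F ⊗ K⁻¹ + 1 ⊗ F` on `V^{⊗(n+1)} = V^{⊗n} ⊗ V`. -/
noncomputable def opF (v : k) : (n : ℕ) → Module.End k (⨂[k]^n (V k))
  | 0 => 0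
  | n + 1 => TensorPower.mulEquiv.conj
      (TensorProduct.map (opF v n) (PiTensorProduct.map fun _ : Fin 1 => KinvV v) +
        TensorProduct.map LinearMap.id (PiTensorProduct.map fun _ : Fin 1 => FV k))

/-- The quantum integer `[m] = ∑_{0 ≤ t < m} v^{m - 1 - 2t}`. -/
def qInt (v : k) (m : ℕ) : k := ∑ t ∈ Finset.range m, v ^ ((m : ℤ) - 1 - 2 * t)

/-- The quantum factorial `[n]! = [1] [2] ⋯ [n]`. -/
def qFactorial (v : k) (n : ℕ) : k := ∏ j ∈ Finset.range n, qInt v (j + 1)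

/-- `Φ₁(b) = b ⊗ y_1`. -/
noncomputable def Phi1 {n : ℕ} (b : ⨂[k]^n (V k)) : ⨂[k]^(n + 1) (V k) := tmul b (ty true)

/-- `Φ₂(b) = [w] b ⊗ y_{-1} - v^w F b ⊗ y_1`, for `b` of weight `w`. -/
noncomputable def Phi2 (v : k) {n : ℕ} (w : ℕ) (b : ⨂[k]^n (V k)) : ⨂[k]^(n + 1) (V k) :=
  qInt v w • tmul b (ty false) - v ^ w • tmul (opF v n b) (ty true)

/-- `Walk n a b` is the type of the walks of length `n` on the Bratteli diagram from the empty
partition to the partition `(a, b)`: a vertical (resp. diagonal) edge adds a box to the first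
(resp. second) row. -/
inductive Walk : ℕ → ℕ → ℕ → Type
  /-- the empty walk -/
  | nil : Walk 0 0 0
  /-- `p` followed by a vertical edge -/
  | vertical {n a b : ℕ} (p : Walk n a b) : Walk (n + 1) (a + 1) b
  /-- `p` followed by a diagonal edge -/
  | diagonal {n a b : ℕ} (p : Walk n a b) (h : b < a) : Walk (n + 1) a (b + 1)

/-- The orthogonal maximal vector `c(p) = (Υ_n ⋯ Υ_1)(1)` of a walk `p`, where `Υ_i = Φ₁` for a
vertical and `Υ_i = Φ₂` for a diagonal `i`-th edge; it has weight `a - b`. -/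
noncomputable def Walk.maxVec (v : k) : {n a b : ℕ} → Walk n a b → ⨂[k]^n (V k)
  | _, _, _, nil => tone
  | _, _, _, vertical p => Phi1 (p.maxVec v)
  | _, _, _, @diagonal _ a b p _ => Phi2 v (a - b) (p.maxVec v)

/-- `Ψ(b) = y_1 ⊗ b ⊗ y_{-1} - v y_{-1} ⊗ b ⊗ y_1`. -/
noncomputable def Psi (v : k) {m : ℕ} (b : ⨂[k]^m (V k)) : ⨂[k]^(1 + m + 1) (V k) :=
  tmul (tmul (ty true) b) (ty false) - v • tmul (tmul (ty false) b) (ty true)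

/-- The tensor product of the vectors `y_1`, one for each defect, and `Ψ(b)`, one for each
nesting. -/
noncomputable def Nesting.vec (v : k) : {n d : ℕ} → Nesting n d → ⨂[k]^n (V k)
  | _, _, empty => tone
  | _, _, defect t => tmul (t.vec v) (ty true)
  | _, _, link t b => tmul (t.vec v) (Psi v (b.vec v))

/-! ### The action of the Temperley--Lieb algebra on tensor space -/

/-- The operator `ė` at the tensor positions `a`, `b` of `V^{⊗n}`. With `z₀ = y_{1,-1} - v y_{-1,1}`
and `ż₀` the orthogonal projection of `V ⊗ V` onto `k z₀`, it acts there as `-(v + v⁻¹) ż₀`, so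
`y_{1,1}, y_{-1,-1} ↦ 0`, `y_{1,-1} ↦ -v⁻¹ y_{1,-1} + y_{-1,1}`,
`y_{-1,1} ↦ y_{1,-1} - v y_{-1,1}`. -/
noncomputable def eDot (v : k) {n : ℕ} (a b : Fin n) : Module.End k (⨂[k]^n (V k)) :=
  (tensorBasis k n).constr k fun γ =>
    if γ a = γ b then 0
    else tensorBasis k n (γ ∘ Equiv.swap a b) - (if γ a then v⁻¹ else v) • tensorBasis k n γ

theorem eDot_basis (v : k) {n : ℕ} (a b : Fin n) (γ : Fin n → Bool) :
    eDot v a b (tensorBasis k n γ) = if γ a = γ b then 0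
    else tensorBasis k n (γ ∘ Equiv.swap a b) - (if γ a then v⁻¹ else v) • tensorBasis k n γ := by
  rw [eDot, Module.Basis.constr_basis]

theorem comp_swap_comp_swap {n : ℕ} (a b : Fin n) (γ : Fin n → Bool) :
    (γ ∘ Equiv.swap a b) ∘ Equiv.swap a b = γ := by
  funext x; simp

theorem eDot_sq {v : k} (hv : v ≠ 0) {n : ℕ} (a b : Fin n) :
    eDot v a b * eDot v a b = -(v + v⁻¹) • eDot v a b := by
  refine (tensorBasis k n).ext fun γ => ?_
  rw [Module.End.mul_apply, LinearMap.smul_apply, eDot_basis]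
  by_cases h : γ a = γ b
  · simp [h]
  · have h' : ¬ γ b = γ a := fun e => h e.symm
    rw [if_neg h, map_sub, map_smul, eDot_basis, eDot_basis, if_neg h,
      if_neg (by simpa using h'), comp_swap_comp_swap]
    cases ha : γ a <;> cases hb : γ b <;>
      simp_all [Equiv.swap_apply_left] <;>
      simp only [smul_sub, add_smul, neg_smul, smul_smul, add_mul, neg_mul, inv_mul_cancel₀ hv,
        mul_inv_cancel₀ hv, one_smul] <;> abel

theorem comp_swap_apply_of_ne {n : ℕ} {a b c : Fin n} (h : a ≠ b) (h' : c ≠ b) (γ : Fin n → Bool) :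
    (γ ∘ Equiv.swap a c) b = γ b := by
  simp [Equiv.swap_apply_of_ne_of_ne h.symm h'.symm]

theorem eDot_comm (v : k) {n : ℕ} {a b c d : Fin n} (h1 : a ≠ c) (h2 : a ≠ d) (h3 : b ≠ c)
    (h4 : b ≠ d) : eDot v a b * eDot v c d = eDot v c d * eDot v a b := by
  refine (tensorBasis k n).ext fun γ => ?_
  have e : (γ ∘ Equiv.swap a b) ∘ Equiv.swap c d = (γ ∘ Equiv.swap c d) ∘ Equiv.swap a b := by
    funext x
    simp only [Function.comp_apply]
    congr 1
    simp only [Equiv.swap_apply_def]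
    grind
  rw [Module.End.mul_apply, Module.End.mul_apply, eDot_basis, eDot_basis]
  have f1 := comp_swap_apply_of_ne h1 h3 γ
  have f2 := comp_swap_apply_of_ne h2 h4 γ
  have f3 := comp_swap_apply_of_ne h1.symm h2.symm γ
  have f4 := comp_swap_apply_of_ne h3.symm h4.symm γ
  by_cases hab : γ a = γ b <;> by_cases hcd : γ c = γ d <;>
    simp only [hab, hcd, if_true, if_false, map_zero, map_sub, map_smul, eDot_basis, f1, f2, f3, f4,
      e, sub_zero, smul_zero, smul_sub, smul_smul]
  rw [mul_comm]
  abel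

theorem eDot_braid {v : k} (hv : v ≠ 0) {n : ℕ} {a b c d : Fin n} (hab : a ≠ b) (hcd : c ≠ d)
    (h : (b = c ∧ a ≠ d) ∨ (a = d ∧ c ≠ b)) :
    eDot v a b * eDot v c d * eDot v a b = eDot v a b := by
  refine (tensorBasis k n).ext fun γ => ?_
  rw [Module.End.mul_apply, Module.End.mul_apply, eDot_basis]
  obtain ⟨rfl, had⟩ | ⟨rfl, hcb⟩ := h
  · have s1 : Equiv.swap a b d = d := Equiv.swap_apply_of_ne_of_ne had.symm hcd.symm
    have s2 : Equiv.swap b d a = a := Equiv.swap_apply_of_ne_of_ne hab had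
    cases ha : γ a <;> cases hb : γ b <;> cases hd : γ d <;>
      simp [eDot_basis, ha, hb, hd, s1, s2, comp_swap_comp_swap, hv, smul_sub, smul_smul]
  · have s1 : Equiv.swap a b c = c := Equiv.swap_apply_of_ne_of_ne hcd hcb
    have s2 : Equiv.swap c a b = b := Equiv.swap_apply_of_ne_of_ne hcb.symm hab.symm
    cases ha : γ a <;> cases hb : γ b <;> cases hd : γ c <;>
      simp [eDot_basis, ha, hb, hd, s1, s2, comp_swap_comp_swap, hv, smul_sub, smul_smul]

/-- The representation of `TL_n(-(v + v⁻¹))` on `V^{⊗n}` for which `e_i` acts as `ė` in the tensor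
positions `i`, `i + 1`. -/
noncomputable def tensorRep (v : kˣ) (n : ℕ) :
    TL k n (-((v : k) + (v : k)⁻¹)) →ₐ[k] Module.End k (⨂[k]^n (V k)) :=
  TL.lift _ (fun i => eDot (v : k) ⟨i, by omega⟩ ⟨i + 1, by omega⟩)
    (fun i => eDot_sq v.ne_zero _ _)
    (fun i j h => eDot_braid v.ne_zero (by simp) (by simp) (by simp; omega))
    (fun i j h => eDot_comm _ (by simp; omega) (by simp; omega) (by simp; omega) (by simp; omega))

theorem tensorRep_e (v : kˣ) (n : ℕ) (i : Fin (n - 1)) :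
    tensorRep v n (TL.e _ i) = eDot (v : k) ⟨i, by omega⟩ ⟨i + 1, by omega⟩ :=
  TL.lift_e _ _ _ _ _ i

set_option linter.unusedVariables false in
/-- A copy of `V^{⊗n}` that carries the module structures determined by `v`. -/
def Tens (v : kˣ) (n : ℕ) : Type _ := ⨂[k]^n (V k)

noncomputable instance (v : kˣ) (n : ℕ) : AddCommGroup (Tens v n) :=
  inferInstanceAs (AddCommGroup (⨂[k]^n (V k)))

noncomputable instance (v : kˣ) (n : ℕ) : Module k (Tens v n) :=
  inferInstanceAs (Module k (⨂[k]^n (V k)))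

/-- The identification of `V^{⊗n}` with its copy. -/
noncomputable def Tens.of (v : kˣ) (n : ℕ) : ⨂[k]^n (V k) ≃ₗ[k] Tens v n :=
  LinearEquiv.refl k (⨂[k]^n (V k))

/-- `V^{⊗n}` as a `TL_n(-δ)`-module, for `δ = v + v⁻¹`. -/
noncomputable instance (v : kˣ) (n : ℕ) : Module (TL k n (-((v : k) + (v : k)⁻¹))) (Tens v n) :=
  Module.compHom (⨂[k]^n (V k)) (tensorRep v n).toRingHom

/-- `V^{⊗n}` as a `TL_n(δ)`-module, for `δ = v + v⁻¹`, through the isomorphism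
`TL_n(δ) → TL_n(-δ)`, `e_i ↦ -e_i`: here `e_i` acts as `-ė`. -/
noncomputable instance (v : kˣ) (n : ℕ) : Module (TL k n ((v : k) + (v : k)⁻¹)) (Tens v n) :=
  Module.compHom (Tens v n) (TL.signChange n ((v : k) + (v : k)⁻¹)).toRingHom

theorem Tens.smul_of {v : kˣ} {n : ℕ} (x : TL k n (-((v : k) + (v : k)⁻¹)))
    (m : ⨂[k]^n (V k)) : x • Tens.of v n m = Tens.of v n (tensorRep v n x m) := rfl

theorem Tens.smul_of' {v : kˣ} {n : ℕ} (x : TL k n ((v : k) + (v : k)⁻¹)) (m : ⨂[k]^n (V k)) :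
    x • Tens.of v n m = Tens.of v n (tensorRep v n (TL.signChange n _ x) m) := rfl

instance (v : kˣ) (n : ℕ) : IsScalarTower k (TL k n (-((v : k) + (v : k)⁻¹))) (Tens v n) where
  smul_assoc a x m := by
    obtain ⟨m, rfl⟩ := (Tens.of v n).surjective m
    simp [Tens.smul_of]

instance (v : kˣ) (n : ℕ) : IsScalarTower k (TL k n ((v : k) + (v : k)⁻¹)) (Tens v n) where
  smul_assoc a x m := by
    obtain ⟨m, rfl⟩ := (Tens.of v n).surjective m
    simp [Tens.smul_of']

theorem Tens.e_smul_of {v : kˣ} {n : ℕ} (i : Fin (n - 1)) (m : ⨂[k]^n (V k)) :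
    TL.e (-((v : k) + (v : k)⁻¹)) i • Tens.of v n m
      = Tens.of v n (eDot (v : k) (⟨i, by omega⟩ : Fin n) ⟨i + 1, by omega⟩ m) := by
  rw [Tens.smul_of, tensorRep_e]

theorem Tens.e_smul_of' {v : kˣ} {n : ℕ} (i : Fin (n - 1)) (m : ⨂[k]^n (V k)) :
    TL.e ((v : k) + (v : k)⁻¹) i • Tens.of v n m
      = -Tens.of v n (eDot (v : k) (⟨i, by omega⟩ : Fin n) ⟨i + 1, by omega⟩ m) := by
  rw [Tens.smul_of', TL.signChange, TL.lift_e, map_neg, tensorRep_e, LinearMap.neg_apply, map_neg]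

/-- The `k`-span of the vectors `c(p)`, where `p` runs over the walks to `(a, b)`: the space
underlying `C(λ)` for `λ = (a, b)`. -/
noncomputable def cellSpace (v : kˣ) (n a b : ℕ) : Submodule k (Tens v n) :=
  Submodule.span k (Set.range fun p : Walk n a b => Tens.of v n (p.maxVec (v : k)))

/-- The vector `N(ℓ)` in `V^{⊗n}` of a link diagram `ℓ` on `n` vertices. -/
noncomputable def LinkDiagram.vec (v : kˣ) {n : ℕ} (l : LinkDiagram n) : Tens v n :=
  Tens.of v n (l.nesting.2.vec (v : k))

end Tensor

end TLCell

open TLCell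

/-!
The vectors `N(ℓ)` of the link diagrams with `d = λ₁ - λ₂` defects are shown to be a basis of `C(λ)`
on which the generators act as they do on the cell module.

*Spans.* On `N(ℓ)`, where `ℓ` has `d` defects, `Φ₂` takes the value `∑ j, [j] N(ℓ_j)`, where `ℓ_j`
is obtained from `ℓ` followed by one more defect by linking the defects number `j` and `j + 1`; `Φ₁`
appends a defect. Hence every vector of a walk is a combination of vectors of diagrams. Conversely,
the diagram whose last vertex is linked occurs in such a formula with the coefficient `[d + 1]`,
which is invertible because `[n]! ≠ 0`, and induction on `n` shows that each `N(ℓ)` is a combination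
of vectors of walks (`coeffs_Phi2_defect`, `walkSpan_eq_nestingSpan`).

*Independence.* In the lexicographic order the largest word in `N(ℓ)` has `y_{-1}` at the right ends
of the links; it has the coefficient `1`, and it determines `ℓ` (`linearIndependent_vec`).

*Action.* The coefficient of `N(ℓ)` at a word is a product of one factor for each vertex
(`LinkDiagram.coeffs_vec`). Only the factors at `i`, `i + 1` and their partners are affected by
stacking the diagram of `e_i`, so that the formula for `e_i N(ℓ)` is a finite check
(`LinkDiagram.eDot_weights_stack`, `eDot_vec`). If `i` and `i + 1` are both defects, the result is
`0`, and the stacked diagram has fewer defects. This identifies the span of the `N(ℓ)` with the cell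
module of `TL_n(-δ)` (`CellModule.exists_equiv`).

*The other sign.* For the parameter `-v` the loop value is `δ` instead of `-δ`. A diagonal sign
matrix on `V^{⊗n}` turns the action of `e_i` for `-v` into that of `-e_i` for `v` (`eDot_signOp`)
and maps the vector of each walk for `-v` to a multiple of the one for `v` (`Walk.signOp_maxVec`).
So the transported vectors `N(ℓ)` for `-v` identify `C(λ)` with the cell module of `TL_n(δ)`.
-/

namespace TLCell

open scoped TensorProduct

/-! ### Coefficients of tensors -/

section Coefficients

variable {k : Type*} [Field k]

/-- The coefficient of a tensor at the word `y_{γ_0} ⊗ ⋯ ⊗ y_{γ_{n-1}}`, as a function of an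
infinite word `γ` of which only the first `n` letters matter. The codomain does not depend on `n`,
so tensors in spaces `V^{⊗n}` and `V^{⊗n'}` with `n = n'` only propositionally can be compared
without casts. -/
noncomputable def coeffs {n : ℕ} : ⨂[k]^n (V k) →ₗ[k] ((ℕ → Bool) → k) :=
  LinearMap.pi fun γ => (tensorBasis k n).coord fun i => γ i

theorem coeffs_apply {n : ℕ} (x : ⨂[k]^n (V k)) (γ : ℕ → Bool) :
    coeffs x γ = (tensorBasis k n).repr x fun i => γ i := rfl

theorem coeffs_injective {n : ℕ} :
    Function.Injective (coeffs : ⨂[k]^n (V k) → ((ℕ → Bool) → k)) := by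
  intro x y h
  refine (tensorBasis k n).repr.injective (Finsupp.ext fun γ => ?_)
  have := congrFun h fun j => if h : j < n then γ ⟨j, h⟩ else true
  simpa [coeffs_apply] using this

theorem coeffs_basis {n : ℕ} (γ : Fin n → Bool) (η : ℕ → Bool) :
    coeffs (tensorBasis k n γ) η = if γ = (fun i : Fin n => η i) then 1 else 0 := by
  rw [coeffs_apply, Module.Basis.repr_self, Finsupp.single_apply]

theorem tone_eq : (tone : ⨂[k]^0 (V k)) = tensorBasis k 0 Fin.elim0 := by
  rw [tensorBasis_apply, tone]
  congr 1
  exact Subsingleton.elim _ _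

theorem ty_eq (s : Bool) : (ty s : ⨂[k]^1 (V k)) = tensorBasis k 1 fun _ => s := by
  rw [tensorBasis_apply, ty]

theorem coeffs_tone (γ : ℕ → Bool) : coeffs (tone : ⨂[k]^0 (V k)) γ = 1 := by
  rw [tone_eq, coeffs_basis, if_pos (Subsingleton.elim _ _)]

theorem coeffs_ty (s : Bool) (γ : ℕ → Bool) :
    coeffs (ty s : ⨂[k]^1 (V k)) γ = if γ 0 = s then 1 else 0 := by
  rw [ty_eq, coeffs_basis]
  congr 1
  simp [funext_iff, eq_comm]

/-- `tmul` as a bilinear map. -/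
noncomputable def tmulLin (k : Type*) [Field k] (n m : ℕ) :
    ⨂[k]^n (V k) →ₗ[k] ⨂[k]^m (V k) →ₗ[k] ⨂[k]^(n + m) (V k) :=
  (TensorProduct.mk k _ _).compr₂ (TensorPower.mulEquiv (R := k) (M := V k)).toLinearMap

theorem tmulLin_apply {n m : ℕ} (a : ⨂[k]^n (V k)) (b : ⨂[k]^m (V k)) :
    tmulLin k n m a b = tmul a b := rfl

theorem tmul_basis {n m : ℕ} (γ : Fin n → Bool) (η : Fin m → Bool) :
    tmul (tensorBasis k n γ) (tensorBasis k m η) = tensorBasis k (n + m) (Fin.append γ η) := by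
  simp only [tensorBasis_apply]
  refine (TensorPower.tprod_mul_tprod k _ _).trans ?_
  congr 1
  funext j
  refine Fin.addCases (fun i => ?_) (fun i => ?_) j <;> simp

theorem coeffs_tmul {n m : ℕ} (a : ⨂[k]^n (V k)) (b : ⨂[k]^m (V k)) (γ : ℕ → Bool) :
    coeffs (tmul a b) γ = coeffs a γ * coeffs b fun j => γ (n + j) := by
  have : (tmulLin k n m).compr₂ ((LinearMap.proj γ).comp coeffs)
      = ((LinearMap.mul k k).compl₁₂ ((LinearMap.proj γ).comp coeffs)
        ((LinearMap.proj fun j => γ (n + j)).comp coeffs)) := by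
    refine (tensorBasis k n).ext fun η => (tensorBasis k m).ext fun ξ => ?_
    simp only [LinearMap.compr₂_apply, tmulLin_apply, tmul_basis, LinearMap.comp_apply,
      LinearMap.proj_apply, coeffs_basis, LinearMap.compl₁₂_apply, LinearMap.mul_apply']
    rw [mul_ite, mul_one, mul_zero, ← ite_and]
    congr 1
    simp only [funext_iff, eq_iff_iff]
    constructor
    · intro h
      exact ⟨fun i => by simpa using h (Fin.natAdd n i),
        fun i => by simpa using h (Fin.castAdd m i)⟩
    · rintro ⟨h2, h1⟩ j
      refine Fin.addCases (fun i => ?_) (fun i => ?_) j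
      · simpa using h1 i
      · simpa using h2 i
  exact LinearMap.congr_fun (LinearMap.congr_fun this a) b

/-- Associativity of `tmul`, in the case in which both sides have definitionally equal types. -/
theorem tmul_tmul_ty {n m : ℕ} (a : ⨂[k]^n (V k)) (b : ⨂[k]^m (V k)) (s : Bool) :
    (tmul a (tmul b (ty s)) : ⨂[k]^(n + (m + 1)) (V k)) = tmul (tmul a b) (ty s) := by
  apply coeffs_injective
  funext γ
  refine (coeffs_tmul a (tmul b (ty s)) γ).trans
    (Eq.trans ?_ (coeffs_tmul (tmul a b) (ty s) γ).symm)
  simp only [coeffs_tmul, mul_assoc, Nat.add_assoc]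

theorem tmul_tone {n : ℕ} (a : ⨂[k]^n (V k)) : (tmul a tone : ⨂[k]^(n + 0) (V k)) = a := by
  apply coeffs_injective
  funext γ
  exact (coeffs_tmul _ _ _).trans (by simp only [coeffs_tone, mul_one])

/-- Linear maps on `V^{⊗(n+1)}` agree if they agree on the tensors `b ⊗ y_{±1}`. -/
theorem hom_ext_tmul_ty {n : ℕ} {W : Type*} [AddCommGroup W] [Module k W]
    {f g : ⨂[k]^(n + 1) (V k) →ₗ[k] W}
    (h : ∀ b s, f (tmul b (ty s)) = g (tmul b (ty s))) : f = g := by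
  refine (tensorBasis k (n + 1)).ext fun γ => ?_
  have : tensorBasis k (n + 1) γ
      = tmul (tensorBasis k n fun j => γ j.castSucc) (ty (γ (Fin.last n))) := by
    rw [ty_eq, tmul_basis]
    congr 1
    funext j
    refine Fin.lastCases ?_ (fun i => ?_) j
    · exact (Fin.append_right (fun j : Fin n => γ j.castSucc)
        (fun _ : Fin 1 => γ (Fin.last n)) 0).symm
    · exact (Fin.append_left (fun j : Fin n => γ j.castSucc)
        (fun _ : Fin 1 => γ (Fin.last n)) i).symm
  rw [this, h]

/-! ### The operators `F` and `K⁻¹` -/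

theorem tmul_add {n m : ℕ} (a : ⨂[k]^n (V k)) (b c : ⨂[k]^m (V k)) :
    tmul a (b + c) = tmul a b + tmul a c := map_add (tmulLin k n m a) b c

theorem add_tmul {n m : ℕ} (a b : ⨂[k]^n (V k)) (c : ⨂[k]^m (V k)) :
    tmul (a + b) c = tmul a c + tmul b c := LinearMap.map_add₂ (tmulLin k n m) a b c

theorem tmul_smul {n m : ℕ} (r : k) (a : ⨂[k]^n (V k)) (b : ⨂[k]^m (V k)) :
    tmul a (r • b) = r • tmul a b := map_smul (tmulLin k n m a) r b

theorem smul_tmul {n m : ℕ} (r : k) (a : ⨂[k]^n (V k)) (b : ⨂[k]^m (V k)) :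
    tmul (r • a) b = r • tmul a b := LinearMap.map_smul₂ (tmulLin k n m) r a b

theorem tmul_zero {n m : ℕ} (a : ⨂[k]^n (V k)) : tmul a (0 : ⨂[k]^m (V k)) = 0 :=
  map_zero (tmulLin k n m a)

theorem zero_tmul {n m : ℕ} (b : ⨂[k]^m (V k)) : tmul (0 : ⨂[k]^n (V k)) b = 0 :=
  LinearMap.map_zero₂ (tmulLin k n m) b

theorem FV_yVec (s : Bool) : FV k (yVec s) = if s then yVec false else 0 := by
  have : yVec s = Pi.basisFun k Bool s := by simp [yVec]
  rw [FV, this, Module.Basis.constr_basis]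

theorem KinvV_yVec (v : k) (s : Bool) :
    KinvV v (yVec s) = (if s then v⁻¹ else v) • yVec s := by
  have : yVec s = Pi.basisFun k Bool s := by simp [yVec]
  rw [KinvV]
  conv_lhs => rw [this]
  rw [Module.Basis.constr_basis]

/-- The action of `K⁻¹` on `V^{⊗n}`. -/
noncomputable def opKinv (v : k) (n : ℕ) : Module.End k (⨂[k]^n (V k)) :=
  PiTensorProduct.map fun _ => KinvV v

theorem opKinv_basis (v : k) {n : ℕ} (γ : Fin n → Bool) :
    opKinv v n (tensorBasis k n γ)
      = (∏ j, if γ j then v⁻¹ else v) • tensorBasis k n γ := by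
  rw [opKinv, tensorBasis_apply, PiTensorProduct.map_tprod]
  simp only [KinvV_yVec]
  exact MultilinearMap.map_smul_univ _ _ _

theorem opKinv_tone (v : k) : opKinv v 0 tone = tone := by
  rw [tone_eq, opKinv_basis]
  simp

theorem opKinv_ty (v : k) (s : Bool) : opKinv v 1 (ty s) = (if s then v⁻¹ else v) • ty s := by
  rw [ty_eq, opKinv_basis]
  simp

theorem opKinv_tmul (v : k) {n m : ℕ} (a : ⨂[k]^n (V k)) (b : ⨂[k]^m (V k)) :
    opKinv v (n + m) (tmul a b) = tmul (opKinv v n a) (opKinv v m b) := by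
  have : (tmulLin k n m).compr₂ (opKinv v (n + m))
      = (tmulLin k n m).compl₁₂ (opKinv v n) (opKinv v m) := by
    refine (tensorBasis k n).ext fun η => (tensorBasis k m).ext fun ξ => ?_
    simp only [LinearMap.compr₂_apply, LinearMap.compl₁₂_apply, opKinv_basis, map_smul,
      LinearMap.smul_apply]
    rw [tmulLin_apply, tmul_basis, opKinv_basis, Fin.prod_univ_add]
    simp [smul_smul, mul_comm]
  exact LinearMap.congr_fun (LinearMap.congr_fun this a) b

theorem opF_tmul_ty (v : k) {n : ℕ} (b : ⨂[k]^n (V k)) (s : Bool) :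
    opF v (n + 1) (tmul b (ty s))
      = (if s then v⁻¹ else v) • tmul (opF v n b) (ty s) + if s then tmul b (ty false) else 0 := by
  have h1 := opKinv_ty v s
  have h2 : (PiTensorProduct.map fun _ : Fin 1 => FV k) (ty s : ⨂[k]^1 (V k))
      = if s then ty false else 0 := by
    rw [ty, PiTensorProduct.map_tprod]
    simp only [FV_yVec]
    cases s
    · exact MultilinearMap.map_coord_zero _ 0 rfl
    · rfl
  rw [opKinv] at h1
  simp only [opF, tmul, LinearEquiv.conj_apply, LinearMap.comp_apply, LinearEquiv.coe_coe,
    LinearEquiv.symm_apply_apply, LinearMap.add_apply, TensorProduct.map_tmul, h1, h2, map_add,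
    TensorProduct.tmul_smul, map_smul, LinearMap.id_apply]
  cases s
  · exact congrArg _ (tmul_zero b)
  · rfl

theorem opF_zero_apply (v : k) (x : ⨂[k]^0 (V k)) : opF v 0 x = 0 := rfl

/-- The comultiplication `Δ(F) = F ⊗ K⁻¹ + 1 ⊗ F` for an arbitrary splitting of the tensor
factors. -/
theorem opF_tmul (v : k) {n m : ℕ} (a : ⨂[k]^n (V k)) (b : ⨂[k]^m (V k)) :
    opF v (n + m) (tmul a b) = tmul (opF v n a) (opKinv v m b) + tmul a (opF v m b) := by
  induction m with
  | zero =>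
    have : (opF v n).comp ((tmulLin k n 0) a)
      = (tmulLin k n 0 (opF v n a)).comp (opKinv v 0) := by
      refine (tensorBasis k 0).ext fun ξ => ?_
      have : tensorBasis k 0 ξ = tone := by rw [tone_eq, Subsingleton.elim ξ]
      rw [this, LinearMap.comp_apply, LinearMap.comp_apply, opKinv_tone, tmulLin_apply,
        tmulLin_apply]
      exact (congrArg (opF v n) (tmul_tone a)).trans (tmul_tone _).symm
    have h0 : tmul a (opF v 0 b) = 0 := tmul_zero a
    rw [h0]
    exact (LinearMap.congr_fun this b).trans (add_zero _).symm
  | succ m ih =>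
    have : (opF v (n + m + 1)).comp ((tmulLin k n (m + 1)) a)
      = (tmulLin k n (m + 1) (opF v n a)).comp (opKinv v (m + 1)) +
        (tmulLin k n (m + 1) a).comp (opF v (m + 1)) := by
      refine hom_ext_tmul_ty fun c s => ?_
      simp only [LinearMap.add_apply, LinearMap.comp_apply, tmulLin_apply, opKinv_tmul, opKinv_ty]
      rw [opF_tmul_ty, tmul_smul, tmul_smul, tmul_add, tmul_smul, tmul_tmul_ty, tmul_tmul_ty,
        tmul_tmul_ty]
      refine (opF_tmul_ty v (tmul a c) s).trans ?_
      rw [ih, add_tmul, smul_add]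
      refine (add_assoc _ _ _).trans ?_
      cases s
      · simp only [Bool.false_eq_true, if_false]
        exact congrArg _ (congrArg _ (tmul_zero (m := m + 1) a).symm)
      · simp only [if_true]
        exact congrArg _ (congrArg _ (tmul_tmul_ty a c false).symm)
    exact LinearMap.congr_fun this b

theorem opKinv_Psi {v : k} (hv : v ≠ 0) {m : ℕ} {b : ⨂[k]^m (V k)} (hb : opKinv v m b = b) :
    opKinv v (1 + m + 1) (Psi v b) = Psi v b := by
  simp only [Psi, map_sub, map_smul, opKinv_tmul, opKinv_ty, hb, smul_tmul, tmul_smul]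
  simp [smul_smul, hv]

theorem opF_Psi {v : k} {m : ℕ} {b : ⨂[k]^m (V k)} (hb : opKinv v m b = b)
    (hF : opF v m b = 0) : opF v (1 + m + 1) (Psi v b) = 0 := by
  have h (s : Bool) : opF v 1 (ty s) = if s then ty false else 0 := by
    have e (s : Bool) : (tmul (tone : ⨂[k]^0 (V k)) (ty s) : ⨂[k]^(0 + 1) (V k)) = ty s := by
      apply coeffs_injective
      funext γ
      simp only [coeffs_tmul, coeffs_tone, one_mul, coeffs_ty, zero_add]
      exact (coeffs_ty s γ).symm
    have := opF_tmul_ty v (tone : ⨂[k]^0 (V k)) s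
    rw [e, e, opF_zero_apply, zero_tmul, smul_zero] at this
    exact this.trans (zero_add _)
  simp only [Psi, map_sub, map_smul, opF_tmul, opKinv_ty, hb, hF, h, tmul_smul,
    tmul_zero]
  simp [tmul_zero, zero_tmul]

/-- The vector of a diagram without defects is fixed by `K⁻¹` and killed by `F`, so that `F` passes
through it in a tensor product. -/
theorem Nesting.opKinv_opF_vec {v : k} (hv : v ≠ 0) {n d : ℕ} (t : Nesting n d) (hd : d = 0) :
    opKinv v n (t.vec v) = t.vec v ∧ opF v n (t.vec v) = 0 := by
  induction t with
  | empty => exact ⟨opKinv_tone v, rfl⟩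
  | defect t => omega
  | link t b iht ihb =>
    obtain ⟨h1, h2⟩ := iht hd
    obtain ⟨h3, h4⟩ := ihb rfl
    simp only [vec]
    rw [opKinv_tmul, opF_tmul, opKinv_Psi hv h3, opF_Psi h3 h4, h1, h2, zero_tmul, tmul_zero,
      add_zero]
    exact ⟨rfl, rfl⟩

end Coefficients

/-! ### The vectors of walks span the same space as the vectors of diagrams -/

section Spans

variable {k : Type*} [Field k]

/-- The span of the vectors of the nestings with `n` vertices and `d` defects. -/
noncomputable def nestingSpan (v : k) (n d : ℕ) : Submodule k (⨂[k]^n (V k)) :=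
  Submodule.span k (Set.range fun t : Nesting n d => t.vec v)

/-- The span of the vectors of the walks of length `n` to the partition `(a, b)`. -/
noncomputable def walkSpan (v : k) (n a b : ℕ) : Submodule k (⨂[k]^n (V k)) :=
  Submodule.span k (Set.range fun p : Walk n a b => p.maxVec v)

theorem qInt_succ {v : k} (hv : v ≠ 0) (m : ℕ) : v * qInt v (m + 1) = v ^ (m + 1) + qInt v m := by
  rw [qInt, Finset.sum_range_succ', mul_add, qInt, Finset.mul_sum, add_comm]
  congr 1
  · rw [← zpow_one_add₀ hv, ← zpow_natCast]
    congr 1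
    push_cast
    ring
  · refine Finset.sum_congr rfl fun t _ => ?_
    rw [← zpow_one_add₀ hv]
    congr 1
    push_cast
    ring

theorem qInt_zero (v : k) : qInt v 0 = 0 := by simp [qInt]

namespace Nesting

theorem le {n d : ℕ} (t : Nesting n d) : d ≤ n := by
  induction t <;> omega

theorem exists_of_eq {n n' d : ℕ} (v : k) (h : n = n') (t : Nesting n d) :
    ∃ u : Nesting n' d, coeffs (u.vec v) = coeffs (t.vec v) := by
  subst h
  exact ⟨t, rfl⟩

/-- Juxtaposition of diagrams corresponds to the tensor product of their vectors. -/
theorem exists_append (v : k) {n d m e : ℕ} (t : Nesting n d) (s : Nesting m e) :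
    ∃ u : Nesting (n + m) (d + e), coeffs (u.vec v) = coeffs (tmul (t.vec v) (s.vec v)) := by
  induction s with
  | empty => exact ⟨t, congrArg _ (tmul_tone _).symm⟩
  | defect s ih =>
    obtain ⟨u, hu⟩ := ih
    refine ⟨defect u, funext fun γ => ?_⟩
    refine (coeffs_tmul (u.vec v) (ty true) γ).trans ?_
    simp only [vec, coeffs_tmul, hu, mul_assoc, Nat.add_assoc]
  | link s b ih _ =>
    obtain ⟨u, hu⟩ := ih
    obtain ⟨w, hw⟩ := exists_of_eq v (Nat.add_assoc _ _ _) (link u b)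
    refine ⟨w, hw.trans (funext fun γ => ?_)⟩
    simp only [vec, coeffs_tmul, hu, mul_assoc, Nat.add_assoc]

end Nesting

/-- `Phi2` as a linear map. -/
noncomputable def phi2Lin (v : k) (n w : ℕ) : ⨂[k]^n (V k) →ₗ[k] ⨂[k]^(n + 1) (V k) :=
  qInt v w • (tmulLin k n 1).flip (ty false)
    - v ^ w • ((tmulLin k n 1).flip (ty true)).comp (opF v n)

theorem phi2Lin_apply (v : k) {n : ℕ} (w : ℕ) (b : ⨂[k]^n (V k)) :
    phi2Lin v n w b = Phi2 v w b := rfl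

/-- The recursion behind the comparison of the two spans. If `t` is a diagram with `d` defects,
followed by one more defect and a diagram `s` without defects, then `Φ₂` of its vector is `[d + 1]`
times the vector of the diagram in which the last defect is linked to the new vertex, plus the
vector obtained by applying `Φ₂` to `t` alone and appending `s` and a defect. -/
theorem coeffs_Phi2_defect {v : k} (hv : v ≠ 0) {n d m : ℕ} (t : Nesting n d) (s : Nesting m 0) :
    coeffs (Phi2 v (d + 1) (tmul (tmul (t.vec v) (ty true)) (s.vec v)))
      = qInt v (d + 1) • coeffs ((Nesting.link t s).vec v)
        + coeffs (Phi1 (tmul (Phi2 v d (t.vec v)) (s.vec v))) := by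
  obtain ⟨hK, hF⟩ := s.opKinv_opF_vec hv rfl
  have h := qInt_succ hv d
  funext γ
  simp only [Phi2, opF_tmul, hK, hF, tmul_zero, add_zero, opF_tmul_ty, if_true, Nesting.vec, Psi,
    Phi1, Pi.add_apply, Pi.smul_apply, Pi.sub_apply, smul_eq_mul, coeffs_tmul, coeffs_ty,
    map_sub, map_smul, map_add, add_zero]
  have e : n + (1 + m) = n + 1 + m := by omega
  rw [e]
  simp only [← Nat.add_assoc]
  have hvv : v ^ (d + 1) * v⁻¹ = v ^ d := by
    rw [pow_succ, mul_assoc, mul_inv_cancel₀ hv, mul_one]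
  -- The two letters at the ends of the new link decide which terms survive.
  cases γ n <;> cases γ (n + 1 + m) <;> simp
  · linear_combination (coeffs (t.vec v) γ * coeffs (s.vec v) fun j => γ (n + 1 + j)) * h
  · linear_combination
      (coeffs (opF v n (t.vec v)) γ * coeffs (s.vec v) fun j => γ (n + 1 + j)) * hvv

theorem mem_map_coeffs {n : ℕ} {S : Submodule k (⨂[k]^n (V k))} {x : ⨂[k]^n (V k)} :
    coeffs x ∈ S.map coeffs ↔ x ∈ S :=
  ⟨fun ⟨_, hy, h⟩ => coeffs_injective h ▸ hy, fun h => ⟨x, h, rfl⟩⟩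

theorem Nesting.vec_mem (v : k) {n d : ℕ} (t : Nesting n d) : t.vec v ∈ nestingSpan v n d :=
  Submodule.subset_span ⟨t, rfl⟩

theorem tmul_mem_nestingSpan (v : k) {n d m e : ℕ} (s : Nesting m e) {x : ⨂[k]^n (V k)}
    (hx : x ∈ nestingSpan v n d) : tmul x (s.vec v) ∈ nestingSpan v (n + m) (d + e) := by
  suffices h : nestingSpan v n d
      ≤ (nestingSpan v (n + m) (d + e)).comap ((tmulLin k n m).flip (s.vec v)) from h hx
  rw [nestingSpan, Submodule.span_le]
  rintro _ ⟨t, rfl⟩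
  obtain ⟨u, hu⟩ := Nesting.exists_append v t s
  change tmul (t.vec v) (s.vec v) ∈ nestingSpan v (n + m) (d + e)
  rw [← coeffs_injective hu]
  exact u.vec_mem v

theorem Phi1_mem_nestingSpan (v : k) {n d : ℕ} {x : ⨂[k]^n (V k)}
    (hx : x ∈ nestingSpan v n d) : Phi1 x ∈ nestingSpan v (n + 1) (d + 1) := by
  suffices h : nestingSpan v n d
      ≤ (nestingSpan v (n + 1) (d + 1)).comap ((tmulLin k n 1).flip (ty true)) from h hx
  rw [nestingSpan, Submodule.span_le]
  rintro _ ⟨t, rfl⟩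
  exact (Nesting.defect t).vec_mem v

/-- There is no walk into the second row from a partition with two equal rows, and `Φ₂` vanishes
there accordingly. -/
theorem Nesting.Phi2_vec_of_closed {v : k} (hv : v ≠ 0) {n : ℕ} (t : Nesting n 0) :
    Phi2 v 0 (t.vec v) = 0 := by
  rw [Phi2, (t.opKinv_opF_vec hv rfl).2, qInt_zero, zero_tmul, zero_smul, smul_zero, sub_zero]

/-- `Φ₂` maps the vector of a diagram with `e + 1` defects to a combination of vectors of diagrams
with `e` defects. The trailing diagram `s` without defects collects the nestings to the right of the
last defect of `t`. -/
theorem Nesting.Phi2_tmul_mem_nestingSpan {v : k} (hv : v ≠ 0) {n d : ℕ} (t : Nesting n d) :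
    ∀ {m e : ℕ} (s : Nesting m 0), d = e + 1 →
      Phi2 v d (tmul (t.vec v) (s.vec v)) ∈ nestingSpan v (n + m + 1) e := by
  induction t with
  | empty => intro m e s h; omega
  | @defect n d t ih =>
    intro m e s h
    obtain rfl : d = e := by omega
    rw [← mem_map_coeffs]
    simp only [vec]
    rw [coeffs_Phi2_defect hv]
    refine add_mem (Submodule.smul_mem _ _ ?_) ?_
    · obtain ⟨u, hu⟩ := exists_of_eq (n' := n + 1 + m + 1) v (by omega) (link t s)
      rw [← hu, mem_map_coeffs]
      exact u.vec_mem v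
    · rw [mem_map_coeffs]
      rcases d with _ | d
      · rw [t.Phi2_vec_of_closed hv, zero_tmul, Phi1, zero_tmul]
        exact zero_mem _
      · have := ih empty rfl
        rw [vec, tmul_tone] at this
        exact Phi1_mem_nestingSpan v (tmul_mem_nestingSpan v s this)
  | @link n d m' t b iht _ =>
    intro m e s h
    obtain ⟨u, hu⟩ := exists_append v (link empty b) s
    have := iht u h
    obtain ⟨hK, hF⟩ := u.opKinv_opF_vec hv rfl
    obtain ⟨hK', hF'⟩ := s.opKinv_opF_vec hv rfl
    obtain ⟨hK1, hF1⟩ := b.opKinv_opF_vec hv rfl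
    have e1 : coeffs (Phi2 v d (tmul (t.vec v) (u.vec v)))
        = coeffs (Phi2 v d (tmul ((link t b).vec v) (s.vec v))) := by
      funext γ
      simp only [Phi2, opF_tmul, hK, hF, hK', hF', vec, tmul_zero, add_zero, opKinv_Psi hv hK1,
        opF_Psi hK1 hF1, map_sub, map_smul, Pi.sub_apply, Pi.smul_apply, coeffs_tmul, hu,
        coeffs_tone, one_mul, zero_add]
      simp only [mul_assoc, Nat.add_assoc]
    have e2 : n + (0 + (1 + m' + 1) + m) + 1 = n + (1 + m' + 1) + m + 1 := by omega
    rw [← mem_map_coeffs, ← e1, ← e2, mem_map_coeffs]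
    exact this

theorem Phi2_mem_nestingSpan {v : k} (hv : v ≠ 0) {n d : ℕ} {x : ⨂[k]^n (V k)}
    (hx : x ∈ nestingSpan v n (d + 1)) : Phi2 v (d + 1) x ∈ nestingSpan v (n + 1) d := by
  suffices h : nestingSpan v n (d + 1)
      ≤ (nestingSpan v (n + 1) d).comap (phi2Lin v n (d + 1)) from h hx
  rw [nestingSpan, Submodule.span_le]
  rintro _ ⟨t, rfl⟩
  have := t.Phi2_tmul_mem_nestingSpan hv Nesting.empty rfl
  rw [Nesting.vec, tmul_tone] at this
  exact this

theorem Walk.le {n a b : ℕ} (p : Walk n a b) : b ≤ a := by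
  induction p <;> omega

theorem Walk.maxVec_mem_nestingSpan {v : k} (hv : v ≠ 0) {n a b : ℕ} (p : Walk n a b) :
    p.maxVec v ∈ nestingSpan v n (a - b) := by
  induction p with
  | nil => exact Nesting.empty.vec_mem v
  | @vertical n a b p ih =>
    rw [Nat.succ_sub p.le]
    exact Phi1_mem_nestingSpan v ih
  | @diagonal n a b p h ih =>
    obtain ⟨d, hd⟩ : ∃ d, a - b = d + 1 := ⟨a - b - 1, by omega⟩
    obtain hd' : a - (b + 1) = d := by omega
    rw [maxVec, hd, hd']
    rw [hd] at ih
    exact Phi2_mem_nestingSpan hv ih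

theorem Phi1_mem_walkSpan (v : k) {n a b : ℕ} {x : ⨂[k]^n (V k)}
    (hx : x ∈ walkSpan v n a b) : Phi1 x ∈ walkSpan v (n + 1) (a + 1) b := by
  suffices h : walkSpan v n a b
      ≤ (walkSpan v (n + 1) (a + 1) b).comap ((tmulLin k n 1).flip (ty true)) from h hx
  rw [walkSpan, Submodule.span_le]
  rintro _ ⟨p, rfl⟩
  exact Submodule.subset_span ⟨p.vertical, rfl⟩

theorem Phi2_mem_walkSpan (v : k) {n a b : ℕ} (h : b < a) {x : ⨂[k]^n (V k)}
    (hx : x ∈ walkSpan v n a b) : Phi2 v (a - b) x ∈ walkSpan v (n + 1) a (b + 1) := by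
  suffices h : walkSpan v n a b
      ≤ (walkSpan v (n + 1) a (b + 1)).comap (phi2Lin v n (a - b)) from h hx
  rw [walkSpan, Submodule.span_le]
  rintro _ ⟨p, rfl⟩
  exact Submodule.subset_span ⟨p.diagonal h, rfl⟩

theorem qInt_ne_zero {v : k} {n : ℕ} (hn : qFactorial v n ≠ 0) {m : ℕ} (hm : m < n) :
    qInt v (m + 1) ≠ 0 := fun h =>
  hn (Finset.prod_eq_zero (Finset.mem_range.2 hm) h)

/-- By induction on `n`: if the last vertex of the diagram is a defect, `Φ₁` produces it; otherwise
`coeffs_Phi2_defect` is solved for the vector of the diagram, which is where `[d + 1] ≠ 0` is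
used. -/
theorem Nesting.vec_mem_walkSpan {v : k} (hv : v ≠ 0) (n : ℕ) : ∀ {d a b : ℕ} (t : Nesting n d),
    qFactorial v n ≠ 0 → a + b = n → a = b + d → t.vec v ∈ walkSpan v n a b := by
  induction n using Nat.strong_induction_on with
  | _ n ih =>
    intro d a b t hn hab hd
    have ih' : ∀ n' < n, ∀ {d a b : ℕ}, a + b = n' → a = b + d →
        nestingSpan v n' d ≤ walkSpan v n' a b := by
      intro n' hn' d a b h1 h2
      rw [nestingSpan, Submodule.span_le]
      rintro _ ⟨t, rfl⟩
      refine ih n' hn' t (fun h => ?_) h1 h2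
      rw [qFactorial, Finset.prod_eq_zero_iff] at h
      obtain ⟨j, hj, hj'⟩ := h
      exact qInt_ne_zero hn ((Finset.mem_range.1 hj).trans hn') hj'
    cases t with
    | empty =>
      obtain rfl : a = 0 := by omega
      obtain rfl : b = 0 := by omega
      exact Submodule.subset_span ⟨Walk.nil, rfl⟩
    | @defect n d t =>
      obtain ⟨a, rfl⟩ : ∃ a', a = a' + 1 := ⟨a - 1, by omega⟩
      exact Phi1_mem_walkSpan v (ih' n (by omega) (by omega) (by omega) (t.vec_mem v))
    | @link n _ m t s =>
      have := t.le
      obtain ⟨b, rfl⟩ : ∃ b', b = b' + 1 := ⟨b - 1, by omega⟩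
      have key := coeffs_Phi2_defect hv t s
      have e1 : n + 1 + m = n + (1 + m) := by omega
      have hw : a - b = d + 1 := by omega
      obtain ⟨u, hu⟩ := exists_append v (defect t) s
      have h1 := Phi2_mem_walkSpan v (by omega) (ih' (n + 1 + m) (by omega) (a := a) (b := b)
        (by omega) (by omega) (u.vec_mem v))
      have h2 : Phi1 (tmul (Phi2 v d (t.vec v)) (s.vec v))
          ∈ walkSpan v (n + 1 + m + 1) a (b + 1) := by
        rcases d with _ | d
        · rw [t.Phi2_vec_of_closed hv, zero_tmul, Phi1, zero_tmul]
          exact zero_mem _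
        · obtain ⟨a, rfl⟩ : ∃ a', a = a' + 1 := ⟨a - 1, by omega⟩
          exact Phi1_mem_walkSpan v (ih' (n + 1 + m) (by omega) (by omega) (by omega)
            (tmul_mem_nestingSpan v s (Phi2_mem_nestingSpan hv (t.vec_mem v))))
      rw [coeffs_injective hu, hw] at h1
      rw [← mem_map_coeffs] at h1 h2 ⊢
      have h3 := sub_mem h1 h2
      simp only [vec] at h3
      rw [key, add_sub_cancel_right,
        Submodule.smul_mem_iff _ (qInt_ne_zero hn (by omega))] at h3
      rw [e1] at h3
      exact h3

/-- If `[n]! ≠ 0`, the vectors of the walks span the same space as those of the nestings. -/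
theorem walkSpan_eq_nestingSpan {v : k} (hv : v ≠ 0) {n a b : ℕ} (hn : qFactorial v n ≠ 0)
    (hle : b ≤ a) (hsum : a + b = n) : walkSpan v n a b = nestingSpan v n (a - b) := by
  refine le_antisymm ?_ ?_
  · rw [walkSpan, Submodule.span_le]
    rintro _ ⟨p, rfl⟩
    exact p.maxVec_mem_nestingSpan hv
  · rw [nestingSpan, Submodule.span_le]
    rintro _ ⟨t, rfl⟩
    exact t.vec_mem_walkSpan hv n hn hsum (by omega)

end Spans

/-! ### Coefficients of the vector of a link diagram -/

section Weights

variable {k : Type*} [Field k]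

/-- The factor which the vertex `x` contributes to the coefficient at the word `γ` of the vector of
the diagram with partner function `p`. The factor `1` or `-v` of a link is attributed to its left
end. -/
def weight (v : k) (p : ℕ → ℕ) (γ : ℕ → Bool) (x : ℕ) : k :=
  if p x = x then (if γ x then 1 else 0)
  else if x < p x then (if γ x = γ (p x) then 0 else if γ x then 1 else -v)
  else 1

/-- The coefficients of the vector of a diagram in terms of its partner function. This replaces the
recursive description of the vector by one that is suited to stacking. -/
theorem Nesting.coeffs_vec (v : k) {n d : ℕ} (t : Nesting n d) : ∀ γ : ℕ → Bool,
    coeffs (t.vec v) γ = ∏ x ∈ Finset.range n, weight v t.partner γ x := by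
  induction t with
  | empty => intro γ; simp [vec, coeffs_tone]
  | @defect n d t ih =>
    intro γ
    have h := t.partner_of_le n le_rfl
    rw [Finset.prod_range_succ, vec, coeffs_tmul, ih, coeffs_ty]
    change _ = (∏ x ∈ Finset.range n, weight v t.partner γ x) * weight v t.partner γ n
    congr 1
    simp [weight, h]
  | @link n d m t b iht ihb =>
    intro γ
    rw [Finset.prod_range_add, Finset.prod_range_succ, Finset.prod_range_add, vec, coeffs_tmul,
      iht]
    congr 1
    · refine Finset.prod_congr rfl fun x hx => ?_
      have hx := Finset.mem_range.1 hx
      simp [weight, partner, hx]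
    · simp only [Psi, map_sub, map_smul, Pi.sub_apply, Pi.smul_apply, coeffs_tmul, coeffs_ty,
        Finset.prod_range_one, ihb, smul_eq_mul]
      have h1 : weight v (link t b).partner γ (n + 0)
          = if γ n = γ (n + (1 + m)) then 0 else if γ n then 1 else -v := by
        simp [weight, partner, Nat.add_assoc]
      have h2 : weight v (link t b).partner γ (n + (1 + m)) = 1 := by
        simp [weight, partner, Nat.add_assoc]
      have h3 : ∀ x ∈ Finset.range m, weight v (link t b).partner γ (n + (1 + x))
          = weight v b.partner (fun j => γ (n + (1 + j))) x := by
        intro x hx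
        have hx := Finset.mem_range.1 hx
        have h4 : (link t b).partner (n + (1 + x)) = n + (1 + b.partner x) := by
          have : n + (1 + x) - (n + 1) = x := by omega
          simp only [partner, this]
          grind
        simp only [weight, h4]
        congr 1 <;> simp
      rw [h1, h2, Finset.prod_congr rfl h3]
      simp only [add_zero]
      cases γ n <;> cases γ (n + (1 + m)) <;> simp

theorem LinkDiagram.nesting_partner {n : ℕ} (l : LinkDiagram n) :
    l.nesting.2.partner = l.partner :=
  l.existsUnique_nesting.choose_spec.1

theorem LinkDiagram.coeffs_vec (v : k) {n : ℕ} (l : LinkDiagram n) (γ : ℕ → Bool) :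
    coeffs (l.nesting.2.vec v) γ = ∏ x ∈ Finset.range n, weight v l.partner γ x := by
  rw [Nesting.coeffs_vec, l.nesting_partner]

namespace Nesting

theorem card_defects {n d : ℕ} (t : Nesting n d) :
    ((Finset.range n).filter fun x => t.partner x = x).card = d := by
  rw [Finset.card_filter]
  induction t with
  | empty => rfl
  | @defect n d t ih =>
    rw [Finset.sum_range_succ]
    change (∑ x ∈ Finset.range n, if t.partner x = x then 1 else 0)
      + (if t.partner n = n then 1 else 0) = d + 1
    rw [ih, if_pos (t.partner_of_le n le_rfl)]
  | @link n d m t b iht ihb =>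
    rw [Finset.sum_range_add, Finset.sum_range_succ, Finset.sum_range_add, Finset.sum_range_one]
    have h1 : ¬ (link t b).partner (n + 0) = n + 0 := by simp [partner]; omega
    have h2 : ¬ (link t b).partner (n + (1 + m)) = n + (1 + m) := by
      simp [partner, Nat.add_assoc]
    have h3 : ∀ x ∈ Finset.range m,
        (if (link t b).partner (n + (1 + x)) = n + (1 + x) then 1 else 0)
        = if b.partner x = x then 1 else 0 := by
      intro x hx
      have hx := Finset.mem_range.1 hx
      have h4 : (link t b).partner (n + (1 + x)) = n + (1 + b.partner x) := by
        have : n + (1 + x) - (n + 1) = x := by omega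
        simp only [partner, this]
        grind
      simp [h4]
    have h5 : ∀ x ∈ Finset.range n, (if (link t b).partner x = x then 1 else 0)
        = if t.partner x = x then 1 else 0 := by
      intro x hx
      simp [partner, Finset.mem_range.1 hx]
    rw [if_neg h1, if_neg h2, Finset.sum_congr rfl h3, Finset.sum_congr rfl h5, iht, ihb]
    rfl

theorem partner_invol {n d : ℕ} (t : Nesting n d) : ∀ x, t.partner (t.partner x) = x := by
  induction t with
  | empty => intro x; rfl
  | defect t ih => exact ih
  | @link n d m t b iht ihb =>
    intro x
    have := iht x
    have := ihb (x - (n + 1))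
    have := t.partner_lt x
    have := b.partner_lt (x - (n + 1))
    simp only [partner]
    grind

theorem partner_ne {n d : ℕ} (t : Nesting n d) (hd : d = 0) :
    ∀ x, x < n → t.partner x ≠ x := by
  intro x hx h
  have := t.card_defects.trans hd
  rw [Finset.card_eq_zero] at this
  exact Finset.notMem_empty x (this ▸ Finset.mem_filter.2 ⟨Finset.mem_range.2 hx, h⟩)

theorem partner_planar {n d : ℕ} (t : Nesting n d) : ∀ x y, x < y → y < t.partner x →
    x < t.partner y ∧ t.partner y < t.partner x ∧ t.partner y ≠ y := by
  induction t with
  | empty => intro x y h1 h2; exact absurd (h1.trans h2) (lt_irrefl _)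
  | defect t ih => exact ih
  | @link n d m t b iht ihb =>
    intro x y hxy hy
    have := iht x y hxy
    have := ihb (x - (n + 1)) (y - (n + 1))
    have := t.partner_lt x
    have := t.partner_lt y
    have := b.partner_lt (x - (n + 1))
    have := b.partner_lt (y - (n + 1))
    have := b.partner_ne rfl (y - (n + 1))
    simp only [partner] at hy ⊢
    grind

/-- The link diagram of a nesting. -/
def toLinkDiagram {n d : ℕ} (t : Nesting n d) : LinkDiagram n where
  partner := t.partner
  partner_of_le := t.partner_of_le
  invol := t.partner_invol
  planar := t.partner_planar

theorem nesting_toLinkDiagram {n d : ℕ} (t : Nesting n d) : t.toLinkDiagram.nesting = ⟨d, t⟩ :=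
  t.toLinkDiagram.existsUnique_nesting.unique (t.toLinkDiagram.nesting_partner) rfl

end Nesting

theorem LinkDiagram.nesting_fst {n : ℕ} (l : LinkDiagram n) : l.nesting.1 = l.defects := by
  rw [← l.nesting.2.card_defects, l.nesting_partner, defects]

theorem nestingSpan_eq (v : k) (n d : ℕ) : nestingSpan v n d
    = Submodule.span k ((fun l : LinkDiagram n => l.nesting.2.vec v) '' {l | l.defects = d}) := by
  rw [nestingSpan]
  congr 1
  ext x
  constructor
  · rintro ⟨t, rfl⟩
    refine ⟨t.toLinkDiagram, ?_, ?_⟩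
    · rw [Set.mem_ofPred_eq, ← LinkDiagram.nesting_fst, t.nesting_toLinkDiagram]
    · change t.toLinkDiagram.nesting.2.vec v = t.vec v
      rw [t.nesting_toLinkDiagram]
  · rintro ⟨l, rfl, rfl⟩
    rw [← l.nesting_fst]
    exact ⟨l.nesting.2, rfl⟩

/-! ### Linear independence -/

/-- The leading word of a link diagram: `false` (for `y_{-1}`) at the right end of each link and
`true` (for `y_1`) elsewhere. -/
def LinkDiagram.word {n : ℕ} (l : LinkDiagram n) (x : ℕ) : Bool := decide (x ≤ l.partner x)

theorem LinkDiagram.coeffs_word (v : k) {n : ℕ} (l : LinkDiagram n) :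
    coeffs (l.nesting.2.vec v) l.word = 1 := by
  rw [l.coeffs_vec]
  refine Finset.prod_eq_one fun x _ => ?_
  have := l.invol x
  simp only [weight, word]
  by_cases h : l.partner x = x
  · simp [h]
  by_cases h' : x < l.partner x
  · simp [h, h', h'.le, this]
  · simp [h, h']

/-- The leading word is the largest one in the lexicographic order with a nonzero coefficient: both
ends of a link carry different letters. -/
theorem LinkDiagram.word_le (v : k) {n : ℕ} (l : LinkDiagram n) (γ : ℕ → Bool)
    (h : coeffs (l.nesting.2.vec v) γ ≠ 0) : toLex γ ≤ toLex l.word := by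
  rw [l.coeffs_vec, Finset.prod_ne_zero_iff] at h
  by_contra! hlt
  obtain ⟨x, hx, hx'⟩ := hlt
  simp only [Pi.toLex_apply] at hx hx'
  obtain ⟨h1, h2⟩ := Bool.lt_iff.1 hx'
  have hpx : l.partner x < x := by simpa [word] using h1
  have hxn : x < n := by
    by_contra h
    have := l.partner_of_le x (by omega)
    omega
  have h3 := h (l.partner x) (Finset.mem_range.2 (hpx.trans hxn))
  have h4 := hx _ hpx
  have h5 : l.word (l.partner x) = true := by simp [word, l.invol, hpx.le]
  rw [h5] at h4
  simp [weight, l.invol, hpx, hpx.ne', h2, ← h4] at h3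

/-- Each right end of a link is linked to the same vertex in two diagrams with the same leading
word, by induction on its position. -/
theorem LinkDiagram.partner_eq_of_word {n : ℕ} {l l' : LinkDiagram n} (h : l.word = l'.word) :
    ∀ x, l.partner x < x → l'.partner x = l.partner x := by
  have hw : ∀ x, l.partner x < x ↔ l'.partner x < x := fun x => by
    have := congrFun h x
    simp only [word, decide_eq_decide] at this
    rw [← not_le, ← not_le, this]
  intro x
  induction x using Nat.strong_induction_on with
  | _ x ih =>
    intro hx
    have hx' := (hw x).1 hx
    have i1 := l.invol x
    have i2 := l'.invol x
    rcases lt_trichotomy (l.partner x) (l'.partner x) with hlt | heq | hlt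
    · obtain ⟨a1, a2, a3⟩ := l.planar (l.partner x) (l'.partner x) hlt (by omega)
      have b1 := hw (l'.partner x)
      have b2 := l.invol (l'.partner x)
      have := ih (l.partner (l'.partner x)) (by omega) (by omega)
      have := l'.invol (l.partner (l'.partner x))
      grind
    · exact heq.symm
    · obtain ⟨a1, a2, a3⟩ := l'.planar (l'.partner x) (l.partner x) hlt (by omega)
      have b1 := hw (l.partner x)
      have b2 := l'.invol (l.partner x)
      have := ih (l'.partner (l.partner x)) (by omega) ((hw _).2 (by omega))
      have := l.invol (l'.partner (l.partner x))
      grind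

theorem LinkDiagram.word_injective {n : ℕ} :
    Function.Injective (word : LinkDiagram n → ℕ → Bool) := by
  intro l l' h
  ext x
  have h1 := partner_eq_of_word h
  have h2 := partner_eq_of_word h.symm
  rcases lt_trichotomy (l.partner x) x with hx | hx | hx
  · exact (h1 x hx).symm
  · rcases lt_trichotomy (l'.partner x) x with hx' | hx' | hx'
    · exact h2 x hx'
    · omega
    · have := h2 (l'.partner x) (by rw [l'.invol]; omega)
      have := l'.invol x
      have := l.invol (l'.partner x)
      grind
  · have := h1 (l.partner x) (by rw [l.invol]; omega)
    have := l.invol x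
    have := l'.invol (l.partner x)
    grind

theorem linearIndependent_vec (v : k) (n : ℕ) :
    LinearIndependent k fun l : LinkDiagram n => l.nesting.2.vec v := by
  classical
  rw [linearIndependent_iff']
  intro s g hg
  by_contra! hne
  obtain ⟨l₀, hl₀, h₀⟩ := (s.filter fun l => g l ≠ 0).exists_max_image (fun l => toLex l.word)
    (by obtain ⟨l, hl, h⟩ := hne; exact ⟨l, Finset.mem_filter.2 ⟨hl, h⟩⟩)
  obtain ⟨hs, h⟩ := Finset.mem_filter.1 hl₀
  have := congrFun (congrArg coeffs hg) l₀.word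
  rw [map_sum, Finset.sum_apply, Finset.sum_eq_single_of_mem l₀ hs] at this
  · simp [l₀.coeffs_word, h] at this
  · intro l hl hne
    rw [map_smul, Pi.smul_apply, smul_eq_mul]
    by_contra hmul
    obtain ⟨h1, h2⟩ := mul_ne_zero_iff.1 hmul
    have h3 := l.word_le v l₀.word h2
    exact hne (LinkDiagram.word_injective
      (toLex.injective (le_antisymm (h₀ l (Finset.mem_filter.2 ⟨hl, h1⟩)) h3)))

end Weights

/-! ### The action of the generators on the vectors of link diagrams -/

section Action

variable {k : Type*} [Field k]

theorem coeffs_eDot (v : k) {n : ℕ} (i : ℕ) (h : i < n) (h' : i + 1 < n) (x : ⨂[k]^n (V k))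
    (γ : ℕ → Bool) :
    coeffs (eDot v ⟨i, h⟩ ⟨i + 1, h'⟩ x) γ = if γ i = γ (i + 1) then 0
      else coeffs x (γ ∘ Equiv.swap i (i + 1)) - (if γ i then v⁻¹ else v) * coeffs x γ := by
  set a : Fin n := ⟨i, h⟩ with ha
  set b : Fin n := ⟨i + 1, h'⟩ with hb
  have hs : ∀ γ : ℕ → Bool, (fun j : Fin n => γ (Equiv.swap i (i + 1) j))
      = (fun j : Fin n => γ j) ∘ Equiv.swap a b := by
    intro γ
    funext j
    simp only [Function.comp_apply, Equiv.swap_apply_def, ha, hb, Fin.ext_iff]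
    split_ifs <;> rfl
  have hiff : ∀ η : Fin n → Bool, (η ∘ Equiv.swap a b = fun j : Fin n => γ j)
      ↔ η = (fun j : Fin n => γ j) ∘ Equiv.swap a b := fun η =>
    ⟨fun h => by rw [← h, comp_swap_comp_swap], fun h => by rw [h, comp_swap_comp_swap]⟩
  have : (LinearMap.proj γ).comp (coeffs.comp (eDot v a b))
      = if γ i = γ (i + 1) then 0 else
        (LinearMap.proj (γ ∘ Equiv.swap i (i + 1))).comp coeffs
          - (if γ i then v⁻¹ else v) • (LinearMap.proj γ).comp coeffs := by
    refine (tensorBasis k n).ext fun η => ?_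
    rw [LinearMap.comp_apply, LinearMap.comp_apply, eDot_basis]
    by_cases hη : η = fun j : Fin n => γ j
    · have e1 : η a = γ i := by rw [hη]
      have e2 : η b = γ (i + 1) := by rw [hη]
      rw [e1, e2]
      split_ifs <;> simp [coeffs_basis, hs, hiff]
    · by_cases hη' : η = (fun j : Fin n => γ j) ∘ Equiv.swap a b
      · have e1 : η a = γ (i + 1) := by rw [hη']; simp [hb]
        have e2 : η b = γ i := by rw [hη']; simp [ha]
        rw [e1, e2]
        by_cases hγ : γ i = γ (i + 1)
        · simp [hγ]
        · have hγ' : ¬ γ (i + 1) = γ i := fun h => hγ h.symm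
          rw [if_neg hγ, if_neg hγ']
          cases h1 : γ i <;> cases h2 : γ (i + 1) <;> simp_all [coeffs_basis]
      · split_ifs <;> simp [coeffs_basis, hs, hiff, hη, hη']
  have := LinearMap.congr_fun this x
  rw [LinearMap.comp_apply, LinearMap.comp_apply, LinearMap.proj_apply] at this
  rw [this]
  split_ifs <;> simp

/-- Products over `range n` whose factors agree outside `S` have a common cofactor. -/
theorem prod_range_split {M : Type*} [CommMonoid M] {n : ℕ} {S : Finset ℕ}
    (hS : S ⊆ Finset.range n) {f g h : ℕ → M} (hfg : ∀ x, x ∉ S → f x = g x)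
    (hfh : ∀ x, x ∉ S → f x = h x) :
    ∃ R, (∏ x ∈ Finset.range n, f x = R * ∏ x ∈ S, f x) ∧
      (∏ x ∈ Finset.range n, g x = R * ∏ x ∈ S, g x) ∧
      ∏ x ∈ Finset.range n, h x = R * ∏ x ∈ S, h x := by
  refine ⟨∏ x ∈ Finset.range n \ S, f x, (Finset.prod_sdiff hS).symm, ?_, ?_⟩
  · rw [Finset.prod_congr rfl fun x hx => hfg x (Finset.mem_sdiff.1 hx).2, Finset.prod_sdiff hS]
  · rw [Finset.prod_congr rfl fun x hx => hfh x (Finset.mem_sdiff.1 hx).2, Finset.prod_sdiff hS]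

/-- The vertices outside a set `S` which contains `i` and `i + 1` and is closed under links
contribute the same factor to all terms of the identity for the action of `ė`, so the identity need
only be checked on `S`. -/
theorem eDot_weights {v : k} {n i : ℕ} (l : LinkDiagram n) (γ : ℕ → Bool)
    {S : Finset ℕ} (hS : S ⊆ Finset.range n) (hi : i ∈ S) (hi' : i + 1 ∈ S)
    (hp : ∀ x ∈ S, l.partner x ∈ S) (c : k)
    (h : (if γ i = γ (i + 1) then 0
      else ∏ x ∈ S, weight v l.partner (γ ∘ Equiv.swap i (i + 1)) x
        - (if γ i then v⁻¹ else v) * ∏ x ∈ S, weight v l.partner γ x)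
      = c * ∏ x ∈ S, weight v (LinkDiagram.stackFun i l.partner) γ x) :
    (if γ i = γ (i + 1) then 0
      else ∏ x ∈ Finset.range n, weight v l.partner (γ ∘ Equiv.swap i (i + 1)) x
        - (if γ i then v⁻¹ else v) * ∏ x ∈ Finset.range n, weight v l.partner γ x)
      = c * ∏ x ∈ Finset.range n, weight v (LinkDiagram.stackFun i l.partner) γ x := by
  have hpS : ∀ x, x ∉ S → l.partner x ∉ S := fun x hx h' => hx (l.invol x ▸ hp _ h')
  have hne : ∀ x, x ∉ S → x ≠ i ∧ x ≠ i + 1 := fun x hx =>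
    ⟨fun h => hx (h ▸ hi), fun h => hx (h ▸ hi')⟩
  obtain ⟨R, h1, h2, h3⟩ := prod_range_split hS
    (f := weight v l.partner γ) (g := weight v l.partner (γ ∘ Equiv.swap i (i + 1)))
    (h := weight v (LinkDiagram.stackFun i l.partner) γ)
    (fun x hx => by
      have a := hne x hx
      have b := hne _ (hpS x hx)
      simp only [weight, Function.comp_apply, Equiv.swap_apply_of_ne_of_ne a.1 a.2,
        Equiv.swap_apply_of_ne_of_ne b.1 b.2])
    (fun x hx => by
      have a := hne x hx
      have b := hne _ (hpS x hx)
      simp only [weight, LinkDiagram.stackFun, if_neg a.1, if_neg a.2, if_neg b.1, if_neg b.2])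
  rw [h1, h2, h3]
  rw [mul_left_comm c, ← h]
  split_ifs <;> ring

/-- The possible positions of the partners `a` and `b` of the vertices `i` and `i + 1`, unless both
are defects. Planarity excludes all others. -/
theorem LinkDiagram.partner_cases {n : ℕ} (l : LinkDiagram n) (i : ℕ) {a b : ℕ}
    (ha : l.partner i = a) (hb : l.partner (i + 1) = b) (h : ¬ (a = i ∧ b = i + 1)) :
    (a = i + 1 ∧ b = i) ∨ (a = i ∧ i + 1 < b) ∨ (a < i ∧ b = i + 1) ∨ (a < i ∧ i + 1 < b) ∨
      (b < a ∧ a < i) ∨ (i + 1 < b ∧ b < a) := by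
  have e1 := l.invol i
  have e2 := l.invol (i + 1)
  rw [ha] at e1
  rw [hb] at e2
  have q1 : a ≠ b := fun h => by rw [h, e2] at e1; omega
  have q2 : a = i + 1 → b = i := fun h => by rw [← hb, ← h, e1]
  have q3 : b = i → a = i + 1 := fun h => by rw [← ha, ← e2, h]
  have p1 := l.planar i (i + 1)
  have p2 := l.planar a i
  have p3 := l.planar b i
  have p4 := l.planar b a
  have p5 := l.planar a (i + 1)
  have p6 := l.planar a b
  have p7 := l.planar i b
  have p8 := l.planar (i + 1) a
  rw [e1] at p2 p4 p5 p6 p8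
  rw [e2] at p3 p4 p6 p7
  rw [ha] at p1 p2 p3 p7
  rw [hb] at p1 p5 p8
  generalize l.partner (i + 1) = b' at *
  generalize l.partner i = a' at *
  subst hb ha
  clear e1 e2
  rcases lt_trichotomy a' i with h1 | h1 | h1 <;>
    rcases lt_trichotomy b' (i + 1) with h2 | h2 | h2 <;> omega

theorem weight_defect (v : k) {p : ℕ → ℕ} {x : ℕ} (h : p x = x) (γ : ℕ → Bool) :
    weight v p γ x = if γ x then 1 else 0 := by
  rw [weight, if_pos h]

theorem weight_left (v : k) {p : ℕ → ℕ} {x y : ℕ} (h : p x = y) (hxy : x < y) (γ : ℕ → Bool) :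
    weight v p γ x = if γ x = γ y then 0 else if γ x then 1 else -v := by
  rw [weight, h, if_neg hxy.ne', if_pos hxy]

theorem weight_right (v : k) {p : ℕ → ℕ} {x y : ℕ} (h : p x = y) (hxy : y < x) (γ : ℕ → Bool) :
    weight v p γ x = 1 := by
  rw [weight, h, if_neg hxy.ne, if_neg hxy.not_gt]

theorem prod_three {M : Type*} [CommMonoid M] {a b c : ℕ} (hab : a ≠ b) (hac : a ≠ c)
    (hbc : b ≠ c) (f : ℕ → M) : ∏ x ∈ {a, b, c}, f x = f a * (f b * f c) := by
  rw [Finset.prod_insert (by simp [hab, hac]), Finset.prod_pair hbc]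

theorem prod_four {M : Type*} [CommMonoid M] {a b c d : ℕ} (hab : a ≠ b) (hac : a ≠ c)
    (had : a ≠ d) (hbc : b ≠ c) (hbd : b ≠ d) (hcd : c ≠ d) (f : ℕ → M) :
    ∏ x ∈ {a, b, c, d}, f x = f a * (f b * (f c * f d)) := by
  rw [Finset.prod_insert (by simp [hab, hac, had]), prod_three hbc hbd hcd]

theorem LinkDiagram.stackFun_of_partner {n : ℕ} (l : LinkDiagram n) {i a b : ℕ}
    (ha : l.partner i = a) (hb : l.partner (i + 1) = b) :
    stackFun i l.partner i = i + 1 ∧ stackFun i l.partner (i + 1) = i ∧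
      (a ≠ i + 1 → a ≠ i → stackFun i l.partner a = if b = i + 1 then a else b) ∧
      (b ≠ i → b ≠ i + 1 → stackFun i l.partner b = if a = i then b else a) := by
  have e1 := l.invol i
  have e2 := l.invol (i + 1)
  rw [ha] at e1
  rw [hb] at e2
  refine ⟨by simp [stackFun], by simp [stackFun], fun h1 h2 => ?_, fun h1 h2 => ?_⟩
  · simp [stackFun, h1, h2, e1, hb]
  · simp [stackFun, h1, h2, e2, ha]

/-- Unless both `i` and `i + 1` are defects, `ė` acts on the coefficients as stacking the diagram of
the generator does. -/
theorem LinkDiagram.eDot_weights_stack {v : k} (hv : v ≠ 0) {n : ℕ} (i : Fin (n - 1))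
    (l : LinkDiagram n) (γ : ℕ → Bool)
    (h : ¬ (l.partner i = i ∧ l.partner (i + 1) = i + 1)) :
    (if γ i = γ (i + 1) then 0
      else ∏ x ∈ Finset.range n, weight v l.partner (γ ∘ Equiv.swap (i : ℕ) (i + 1)) x
        - (if γ i then v⁻¹ else v) * ∏ x ∈ Finset.range n, weight v l.partner γ x)
      = loopFactor (-(v + v⁻¹)) i l * ∏ x ∈ Finset.range n, weight v (stack i l).partner γ x := by
  obtain ⟨i, hi⟩ := i
  simp only [stack, loopFactor] at h ⊢
  have hin : i < n := by omega
  have hin' : i + 1 < n := by omega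
  have ha' := l.partner_lt hin
  have hb' := l.partner_lt hin'
  obtain ⟨a, ha⟩ : ∃ a, l.partner i = a := ⟨_, rfl⟩
  obtain ⟨b, hb⟩ : ∃ b, l.partner (i + 1) = b := ⟨_, rfl⟩
  have e1 := l.invol i
  have e2 := l.invol (i + 1)
  rw [ha] at e1 h ha'
  rw [hb] at e2 h hb'
  obtain ⟨q1, q2, q3, q4⟩ := l.stackFun_of_partner ha hb
  rw [ha]
  refine eDot_weights (S := {i, i + 1, a, b}) l γ ?_ (by simp) (by simp) ?_ _ ?_
  · intro x hx
    simp only [Finset.mem_insert, Finset.mem_singleton, Finset.mem_range] at hx ⊢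
    omega
  · intro x hx
    simp only [Finset.mem_insert, Finset.mem_singleton] at hx ⊢
    obtain rfl | rfl | rfl | rfl := hx <;> simp [ha, hb, e1, e2]
  set η := γ ∘ Equiv.swap i (i + 1) with hη
  have s1 : η i = γ (i + 1) := by simp [hη]
  have s2 : η (i + 1) = γ i := by simp [hη]
  have hq : ∀ x, x ≠ i → x ≠ i + 1 → η x = γ x := fun x h1 h2 =>
    congrArg γ (Equiv.swap_apply_of_ne_of_ne h1 h2)
  obtain ⟨rfl, rfl⟩ | ⟨rfl, h1⟩ | ⟨h1, rfl⟩ | ⟨h1, h2⟩ | ⟨h1, h2⟩ | ⟨h1, h2⟩ :=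
    l.partner_cases i ha hb h
  · have hS : ({b, b + 1, b + 1, b} : Finset ℕ) = {b, b + 1} := by grind
    simp only [hS, Finset.prod_pair b.succ_ne_self.symm, weight_left v ha b.lt_succ_self,
      weight_right v hb b.lt_succ_self, weight_left v q1 b.lt_succ_self,
      weight_right v q2 b.lt_succ_self, s1, s2]
    cases γ b <;> cases γ (b + 1) <;> simp
    all_goals field_simp
    all_goals ring
  · have hS : ({a, a + 1, a, b} : Finset ℕ) = {a, a + 1, b} := by grind
    have q4 := q4 (by omega) (by omega)
    rw [if_pos rfl] at q4
    simp only [hS, prod_three a.succ_ne_self.symm (show a ≠ b by omega) h1.ne,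
      weight_defect v ha, weight_left v hb h1, weight_right v e2 h1,
      weight_left v q1 a.lt_succ_self, weight_right v q2 a.lt_succ_self, weight_defect v q4,
      s1, s2, hq b (by omega) (by omega), if_neg a.succ_ne_self.symm]
    cases γ a <;> cases γ (a + 1) <;> cases γ b <;> simp [hv]
  · have hS : ({i, i + 1, a, i + 1} : Finset ℕ) = {i, i + 1, a} := by grind
    have q3 := q3 (by omega) (by omega)
    rw [if_pos rfl] at q3
    simp only [hS, prod_three i.succ_ne_self.symm h1.ne' (show i + 1 ≠ a by omega),
      weight_defect v hb, weight_left v e1 h1, weight_right v ha h1,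
      weight_left v q1 i.lt_succ_self, weight_right v q2 i.lt_succ_self, weight_defect v q3,
      s1, s2, hq a (by omega) (by omega), if_neg (show a ≠ i + 1 by omega)]
    cases γ i <;> cases γ (i + 1) <;> cases γ a <;> simp
  · have q3 := q3 (by omega) (by omega)
    have q4 := q4 (by omega) (by omega)
    have hab : a < b := by omega
    rw [if_neg (by omega)] at q3 q4
    simp only [prod_four i.succ_ne_self.symm h1.ne' (show i ≠ b by omega) (show i + 1 ≠ a by omega)
      h2.ne hab.ne, weight_left v hb h2, weight_left v e1 h1, weight_right v ha h1,
      weight_right v e2 h2, weight_left v q1 i.lt_succ_self, weight_right v q2 i.lt_succ_self,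
      weight_left v q3 hab, weight_right v q4 hab, s1, s2, hq a (by omega) (by omega),
      hq b (by omega) (by omega), if_neg (show a ≠ i + 1 by omega)]
    cases γ i <;> cases γ (i + 1) <;> cases γ a <;> cases γ b <;> simp [hv]
  · have q3 := q3 (by omega) (by omega)
    have q4 := q4 (by omega) (by omega)
    have hb1 : b < i + 1 := by omega
    rw [if_neg (by omega)] at q3 q4
    simp only [prod_four i.succ_ne_self.symm h2.ne' (show i ≠ b by omega) (show i + 1 ≠ a by omega)
      hb1.ne' h1.ne', weight_right v hb hb1, weight_left v e1 h2, weight_right v ha h2,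
      weight_left v e2 hb1, weight_left v q1 i.lt_succ_self, weight_right v q2 i.lt_succ_self,
      weight_right v q3 h1, weight_left v q4 h1, s1, s2, hq a (by omega) (by omega),
      hq b (by omega) (by omega), if_neg (show a ≠ i + 1 by omega)]
    cases γ i <;> cases γ (i + 1) <;> cases γ a <;> cases γ b <;> simp [hv]
  · have q3 := q3 (by omega) (by omega)
    have q4 := q4 (by omega) (by omega)
    have ha1 : i < a := by omega
    rw [if_neg (by omega)] at q3 q4
    simp only [prod_four i.succ_ne_self.symm ha1.ne (show i ≠ b by omega) (show i + 1 ≠ a by omega)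
      h1.ne h2.ne', weight_left v hb h1, weight_right v e1 ha1, weight_left v ha ha1,
      weight_right v e2 h1, weight_left v q1 i.lt_succ_self, weight_right v q2 i.lt_succ_self,
      weight_right v q3 h2, weight_left v q4 h2, s1, s2, hq a (by omega) (by omega),
      hq b (by omega) (by omega), if_neg (show a ≠ i + 1 by omega)]
    cases γ i <;> cases γ (i + 1) <;> cases γ a <;> cases γ b <;> simp [hv]

end Action

section Defects

variable {k : Type*} [Field k]

theorem LinkDiagram.defects_stack_of_not {n : ℕ} (i : Fin (n - 1)) (l : LinkDiagram n)
    (h : ¬ (l.partner i = i ∧ l.partner (i + 1) = i + 1)) : (stack i l).defects = l.defects := by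
  refine le_antisymm (defects_stack_le i l) ?_
  have hi := i.2
  have h1 := l.invol i
  have h2 := l.invol (i + 1)
  have h3 := l.partner_lt (x := i) (by omega)
  have h4 := l.partner_lt (x := i + 1) (by omega)
  refine Finset.card_le_card_of_injOn
    (fun x => if x = i then l.partner (i + 1) else if x = i + 1 then l.partner i else x) ?_ ?_
  · intro x hx
    simp only [stack, stackFun, Finset.coe_filter, Finset.mem_range, Set.mem_ofPred_eq] at hx ⊢
    grind
  · intro x hx y hy hxy
    simp only [Finset.coe_filter, Finset.mem_range, Set.mem_ofPred_eq] at hx hy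
    simp only at hxy
    grind

theorem LinkDiagram.defects_stack_lt {n : ℕ} (i : Fin (n - 1)) (l : LinkDiagram n)
    (h1 : l.partner i = i) (h2 : l.partner (i + 1) = i + 1) : (stack i l).defects < l.defects := by
  have hi := i.2
  refine Finset.card_lt_card ⟨fun x hx => ?_, fun hsub => ?_⟩
  · simp only [stack, stackFun, Finset.mem_filter] at hx ⊢
    have := l.invol x
    grind
  · have := hsub (Finset.mem_filter.2 ⟨Finset.mem_range.2 (by omega : (i : ℕ) < n), h1⟩)
    simp [stack_self] at this

/-- The action of a generator on the vector of a link diagram with `d` defects, modulo the diagrams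
with fewer defects, which are sent to `0`. -/
theorem eDot_vec {v : k} (hv : v ≠ 0) {n d : ℕ} (i : Fin (n - 1)) (l : LinkDiagram n)
    (hl : l.defects = d) :
    eDot v (⟨i, by omega⟩ : Fin n) ⟨i + 1, by omega⟩ (l.nesting.2.vec v)
      = if (LinkDiagram.stack i l).defects = d then
          LinkDiagram.loopFactor (-(v + v⁻¹)) i l • (LinkDiagram.stack i l).nesting.2.vec v
        else 0 := by
  by_cases h : l.partner i = i ∧ l.partner (i + 1) = i + 1
  · rw [if_neg (hl ▸ (LinkDiagram.defects_stack_lt i l h.1 h.2).ne)]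
    apply coeffs_injective
    funext γ
    have hi := i.2
    -- Both vertices carry `y_1`, so no word with different letters there occurs.
    have hz : ∀ η : ℕ → Bool, η i ≠ η (i + 1) → coeffs (l.nesting.2.vec v) η = 0 := by
      intro η hη
      rw [l.coeffs_vec]
      cases h1 : η i
      · refine Finset.prod_eq_zero (Finset.mem_range.2 (by omega : (i : ℕ) < n)) ?_
        simp [weight_defect v h.1, h1]
      · refine Finset.prod_eq_zero (Finset.mem_range.2 (by omega : (i : ℕ) + 1 < n)) ?_
        rw [h1] at hη
        rw [weight_defect v h.2, if_neg hη.symm]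
    rw [coeffs_eDot, map_zero]
    by_cases h1 : γ i = γ (i + 1)
    · rw [if_pos h1]
      rfl
    · rw [if_neg h1, hz γ h1, hz _ (by simpa using fun h => h1 h.symm), mul_zero, sub_zero]
      rfl
  · rw [if_pos (hl ▸ LinkDiagram.defects_stack_of_not i l h)]
    apply coeffs_injective
    funext γ
    rw [coeffs_eDot, map_smul, Pi.smul_apply, smul_eq_mul]
    simp only [LinkDiagram.coeffs_vec]
    exact l.eDot_weights_stack hv i γ h

end Defects

/-! ### Realizations of the cell modules -/

section Cell

variable {k : Type*} [CommRing k]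

theorem L0.mem_spanOf {n : ℕ} {δ : k} {P : LinkDiagram n → Prop} {hP} {x : L0 k n} :
    x ∈ L0.spanOf δ P hP ↔ ∀ l ∈ ((L0.basis k n).repr x).support, P l :=
  Module.Basis.mem_span_image (L0.basis k n)

/-- A linearly independent family on which the generators act as on link diagrams modulo those with
fewer than `d` defects spans a copy of the cell module. -/
theorem CellModule.exists_equiv {n d : ℕ} {δ : k} {M : Type*} [AddCommGroup M] [Module k M]
    [Module (TL k n δ) M] [IsScalarTower k (TL k n δ) M] (N : LinkDiagram n → M)
    (hN : LinearIndependent k N)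
    (hact : ∀ (i : Fin (n - 1)) (l : LinkDiagram n), l.defects = d →
      TL.e δ i • N l = if (LinkDiagram.stack i l).defects = d then
        LinkDiagram.loopFactor δ i l • N (LinkDiagram.stack i l) else 0) :
    ∃ C : Submodule (TL k n δ) M,
      (C : Set M) = (Submodule.span k (N '' {l | l.defects = d}) : Set M) ∧
      ∃ φ : CellModule n δ d ≃ₗ[TL k n δ] C, ∀ (l : LinkDiagram n) (h : l.defects = d),
        ((φ (CellModule.cls δ l h.le) : C) : M) = N l := by
  classical
  set Θ : L0 k n →ₗ[k] M := (L0.basis k n).constr k fun l => if l.defects = d then N l else 0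
    with hΘ
  have hΘb : ∀ l, Θ (L0.basis k n l) = if l.defects = d then N l else 0 := fun l => by
    rw [hΘ, Module.Basis.constr_basis]
  have hlin : ∀ (a : TL k n δ) (x : L0 k n), x ∈ L0.le n δ d → Θ (a • x) = a • Θ x := by
    intro a x hx
    -- It suffices that the graph of `Θ` on `L₀^{≤ d}` is stable under the generators.
    let S : Submodule k (L0 k n × M) :=
      (Submodule.span k (L0.basis k n '' {l | l.defects ≤ d})).map (LinearMap.prod LinearMap.id Θ)
    have hS : ∀ i : Fin (n - 1), ∀ m ∈ S, Algebra.lsmul k k (L0 k n × M) (TL.e δ i) m ∈ S := by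
      rintro i _ ⟨x, hx, rfl⟩
      induction hx using Submodule.span_induction with
      | mem x h =>
        obtain ⟨l, hl, rfl⟩ := h
        have hl' : (LinkDiagram.stack i l).defects ≤ d :=
          (LinkDiagram.defects_stack_le i l).trans hl
        refine ⟨LinkDiagram.loopFactor δ i l • L0.basis k n (LinkDiagram.stack i l),
          Submodule.smul_mem _ _ (Submodule.subset_span ⟨_, hl', rfl⟩), ?_⟩
        refine Prod.ext ?_ ?_
        · exact (L0.e_smul_basis δ i l).symm
        · change Θ (_ • _) = TL.e δ i • Θ _
          rw [map_smul, hΘb, hΘb]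
          by_cases h : l.defects = d
          · rw [if_pos h, hact i l h]
            split_ifs <;> simp
          · have := LinkDiagram.defects_stack_le i l
            have hl : l.defects ≤ d := hl
            rw [if_neg h, if_neg (by omega), smul_zero, smul_zero]
      | zero => rw [map_zero, map_zero]; exact zero_mem S
      | add a b _ _ ha hb => rw [map_add, map_add]; exact add_mem ha hb
      | smul c a _ ha => rw [map_smul, map_smul]; exact Submodule.smul_mem _ _ ha
    obtain ⟨y, -, hy⟩ := TL.apply_mem _ S hS a ⟨x, hx, rfl⟩
    have h1 : y = a • x := congrArg Prod.fst hy
    have h2 : Θ y = a • Θ x := congrArg Prod.snd hy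
    rw [← h1, h2]
  let f : L0.le n δ d →ₗ[TL k n δ] M :=
    { toFun := fun x => Θ x
      map_add' := fun x y => map_add Θ _ _
      map_smul' := fun a x => hlin a x x.2 }
  have hsum : ∀ x : L0 k n, Θ x = Finsupp.linearCombination k N
      (((L0.basis k n).repr x).filter fun l => l.defects = d) := by
    intro x
    rw [hΘ, Module.Basis.constr_apply, Finsupp.linearCombination_apply, Finsupp.sum_filter_index,
      Finsupp.support_filter, Finset.sum_filter, Finsupp.sum]
    refine Finset.sum_congr rfl fun l _ => ?_
    split_ifs <;> simp
  have hker : LinearMap.ker f = (L0.lt n δ d).comap (L0.le n δ d).subtype := by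
    ext ⟨x, hx⟩
    rw [LinearMap.mem_ker, Submodule.mem_comap]
    change Θ x = 0 ↔ x ∈ L0.lt n δ d
    have hx := L0.mem_spanOf.1 hx
    rw [hsum, map_eq_zero_iff _ hN, L0.lt, L0.mem_spanOf, Finsupp.filter_eq_zero_iff]
    constructor
    · intro h l hl
      exact lt_of_le_of_ne (hx l hl) fun hd => Finsupp.mem_support_iff.1 hl (h l hd)
    · intro h l hd
      by_contra hl
      exact (h l (Finsupp.mem_support_iff.2 hl)).ne hd
  have hrange : ((LinearMap.range f : Submodule (TL k n δ) M) : Set M)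
      = (Submodule.span k (N '' {l | l.defects = d}) : Set M) := by
    ext m
    constructor
    · rintro ⟨⟨x, hx⟩, rfl⟩
      change Θ x ∈ Submodule.span k (N '' {l | l.defects = d})
      rw [Finsupp.mem_span_image_iff_linearCombination]
      refine ⟨_, ?_, (hsum x).symm⟩
      rw [Finsupp.mem_supported, Finsupp.support_filter]
      exact fun l hl => (Finset.mem_filter.1 hl).2
    · intro hm
      have : Submodule.span k (N '' {l | l.defects = d})
          ≤ (LinearMap.range f).restrictScalars k := by
        rw [Submodule.span_le]
        rintro _ ⟨l, hl, rfl⟩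
        refine ⟨⟨L0.basis k n l,
          Submodule.subset_span ⟨l, (show l.defects = d from hl).le, rfl⟩⟩, ?_⟩
        exact (hΘb l).trans (if_pos hl)
      exact this hm
  refine ⟨LinearMap.range f, hrange,
    (Submodule.quotEquivOfEq _ _ hker.symm).trans f.quotKerEquivRange, fun l h => ?_⟩
  change Θ (L0.basis k n l) = N l
  rw [hΘb, if_pos h]

end Cell

/-! ### Changing the sign of the parameter -/

section Sign

variable {k : Type*} [Field k]

/-- The factor `(-1)^j` for a letter `y_{-1}` at the position `j`, and `1` for a letter `y_1`. -/
def posSign (k : Type*) [Field k] (s : Bool) (j : ℕ) : k := if s then 1 else (-1) ^ j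

/-- The involution of `V^{⊗n}` that multiplies each basis tensor by `(-1)` to the sum of the
positions of its letters `y_{-1}`. It exchanges the structures for `v` and `-v` up to sign. -/
noncomputable def signOp (k : Type*) [Field k] (n : ℕ) : Module.End k (⨂[k]^n (V k)) :=
  (tensorBasis k n).constr k fun γ => (∏ j : Fin n, posSign k (γ j) j) • tensorBasis k n γ

theorem signOp_basis {n : ℕ} (γ : Fin n → Bool) :
    signOp k n (tensorBasis k n γ) = (∏ j : Fin n, posSign k (γ j) j) • tensorBasis k n γ := by
  rw [signOp, Module.Basis.constr_basis]

theorem signOp_signOp {n : ℕ} (x : ⨂[k]^n (V k)) : signOp k n (signOp k n x) = x := by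
  have : signOp k n ∘ₗ signOp k n = LinearMap.id := by
    refine (tensorBasis k n).ext fun γ => ?_
    have h : ∀ (s : Bool) (j : ℕ), posSign k s j * posSign k s j = 1 := by
      intro s j
      cases s <;> simp [posSign, ← mul_pow]
    rw [LinearMap.comp_apply, signOp_basis, map_smul, signOp_basis, smul_smul,
      ← Finset.prod_mul_distrib]
    simp [h]
  exact LinearMap.congr_fun this x

theorem signOp_tone : signOp k 0 tone = tone := by
  rw [tone_eq, signOp_basis]
  simp

theorem signOp_tmul_ty {n : ℕ} (b : ⨂[k]^n (V k)) (s : Bool) :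
    signOp k (n + 1) (tmul b (ty s)) = posSign k s n • tmul (signOp k n b) (ty s) := by
  have : signOp k (n + 1) ∘ₗ (tmulLin k n 1).flip (ty s)
      = posSign k s n • (tmulLin k n 1).flip (ty s) ∘ₗ signOp k n := by
    refine (tensorBasis k n).ext fun γ => ?_
    simp only [LinearMap.comp_apply, LinearMap.flip_apply, LinearMap.smul_apply, signOp_basis,
      map_smul]
    rw [tmulLin_apply, ty_eq, tmul_basis, signOp_basis, Fin.prod_univ_add, smul_smul]
    simp [mul_comm]
  exact LinearMap.congr_fun this b

theorem signOp_opF (v : k) (n : ℕ) (x : ⨂[k]^n (V k)) :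
    signOp k n (opF (-v) n x) = (-1 : k) ^ (n + 1) • opF v n (signOp k n x) := by
  induction n with
  | zero => rw [opF_zero_apply, opF_zero_apply, map_zero, smul_zero]
  | succ n ih =>
    have : signOp k (n + 1) ∘ₗ opF (-v) (n + 1)
        = (-1 : k) ^ (n + 1 + 1) • opF v (n + 1) ∘ₗ signOp k (n + 1) := by
      refine hom_ext_tmul_ty fun b s => ?_
      rw [LinearMap.comp_apply, LinearMap.smul_apply, LinearMap.comp_apply, signOp_tmul_ty,
        opF_tmul_ty, map_add, map_smul, signOp_tmul_ty, ih, map_smul, opF_tmul_ty, smul_tmul]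
      cases s
      · simp only [posSign, Bool.false_eq_true, if_false, map_zero, add_zero, smul_smul]
        congr 1
        ring
      · simp only [posSign, if_true, signOp_tmul_ty, Bool.false_eq_true, if_false, smul_add,
          smul_smul, inv_neg]
        congr 2 <;> ring
    exact LinearMap.congr_fun this x

theorem qInt_neg {v : k} (hv : v ≠ 0) (m : ℕ) : qInt (-v) m = -(-1) ^ m * qInt v m := by
  induction m with
  | zero => rw [qInt_zero, qInt_zero, mul_zero]
  | succ m ih =>
    have h1 := qInt_succ (neg_ne_zero.2 hv) m
    have h2 := qInt_succ hv m
    refine mul_left_cancel₀ (neg_ne_zero.2 hv) ?_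
    rw [h1, ih, neg_pow]
    linear_combination ((-1) ^ m) * h2

theorem qFactorial_neg_ne_zero {v : k} (hv : v ≠ 0) {n : ℕ} (hn : qFactorial v n ≠ 0) :
    qFactorial (-v) n ≠ 0 := by
  rw [qFactorial, Finset.prod_ne_zero_iff] at hn ⊢
  intro j hj
  rw [qInt_neg hv]
  exact mul_ne_zero (by simp) (hn j hj)

theorem signOp_Phi2 {v : k} (hv : v ≠ 0) {n : ℕ} (w : ℕ) (b : ⨂[k]^n (V k)) :
    signOp k (n + 1) (Phi2 (-v) w b) = (-(-1) ^ (w + n) : k) • Phi2 v w (signOp k n b) := by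
  simp only [Phi2, map_sub, map_smul, signOp_tmul_ty, signOp_opF, qInt_neg hv, smul_tmul, smul_sub,
    smul_smul, posSign, if_true, Bool.false_eq_true, if_false]
  rw [neg_pow v]
  congr 2 <;> ring

theorem Walk.signOp_maxVec {v : k} (hv : v ≠ 0) {n a b : ℕ} (p : Walk n a b) :
    ∃ c : k, c ≠ 0 ∧ signOp k n (p.maxVec (-v)) = c • p.maxVec v := by
  induction p with
  | nil => exact ⟨1, one_ne_zero, by rw [maxVec, signOp_tone, one_smul]; rfl⟩
  | vertical p ih =>
    obtain ⟨c, hc, h⟩ := ih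
    refine ⟨c, hc, ?_⟩
    rw [maxVec, maxVec, Phi1, Phi1, signOp_tmul_ty, h, smul_tmul]
    simp [posSign]
  | @diagonal n a b p _ ih =>
    obtain ⟨c, hc, h⟩ := ih
    refine ⟨-(-1) ^ (a - b + n) * c, mul_ne_zero (by simp) hc, ?_⟩
    rw [maxVec, maxVec, signOp_Phi2 hv, h, ← phi2Lin_apply, map_smul, smul_smul, phi2Lin_apply]

theorem map_signOp_walkSpan {v : k} (hv : v ≠ 0) (n a b : ℕ) :
    (walkSpan (-v) n a b).map (signOp k n) = walkSpan v n a b := by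
  rw [walkSpan, Submodule.map_span, ← Set.range_comp]
  refine le_antisymm ?_ ?_
  · rw [Submodule.span_le]
    rintro _ ⟨p, rfl⟩
    obtain ⟨c, -, h⟩ := p.signOp_maxVec hv
    change signOp k n (p.maxVec (-v)) ∈ _
    rw [h]
    exact Submodule.smul_mem _ _ (Submodule.subset_span ⟨p, rfl⟩)
  · rw [walkSpan, Submodule.span_le]
    rintro _ ⟨p, rfl⟩
    obtain ⟨c, hc, h⟩ := p.signOp_maxVec hv
    have : p.maxVec v = c⁻¹ • signOp k n (p.maxVec (-v)) := by
      rw [h, smul_smul, inv_mul_cancel₀ hc, one_smul]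
    change p.maxVec v ∈ _
    rw [this]
    exact Submodule.smul_mem _ _ (Submodule.subset_span ⟨p, rfl⟩)

/-- `signOp` carries the action of `ė` for the parameter `-v` to that of `-ė` for `v`. -/
theorem eDot_signOp (v : k) {n : ℕ} (i : ℕ) (h : i < n) (h' : i + 1 < n) (x : ⨂[k]^n (V k)) :
    eDot v ⟨i, h⟩ ⟨i + 1, h'⟩ (signOp k n x)
      = -signOp k n (eDot (-v) ⟨i, h⟩ ⟨i + 1, h'⟩ x) := by
  set a : Fin n := ⟨i, h⟩ with ha
  set b : Fin n := ⟨i + 1, h'⟩ with hb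
  have hab : a ≠ b := by simp [ha, hb]
  have hprod : ∀ f : Fin n → k,
      ∏ j, f j = f a * (f b * ∏ j ∈ (Finset.univ.erase a).erase b, f j) := by
    intro f
    rw [Finset.mul_prod_erase _ _ (by simp [hab.symm]), Finset.mul_prod_erase _ _ (by simp)]
  have : eDot v a b ∘ₗ signOp k n = -(signOp k n ∘ₗ eDot (-v) a b) := by
    refine (tensorBasis k n).ext fun γ => ?_
    rw [LinearMap.comp_apply, LinearMap.neg_apply, LinearMap.comp_apply, signOp_basis, map_smul,
      eDot_basis, eDot_basis]
    by_cases hγ : γ a = γ b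
    · simp [hγ]
    have hs : ∏ j : Fin n, posSign k ((γ ∘ Equiv.swap a b) j) j
        = -∏ j : Fin n, posSign k (γ j) j := by
      rw [hprod, hprod]
      have : ∀ j ∈ (Finset.univ.erase a).erase b,
          posSign k ((γ ∘ Equiv.swap a b) j) j = posSign k (γ j) j := by
        intro j hj
        simp only [Finset.mem_erase] at hj
        rw [Function.comp_apply, Equiv.swap_apply_of_ne_of_ne hj.2.1 hj.1]
      rw [Finset.prod_congr rfl this]
      simp only [Function.comp_apply, Equiv.swap_apply_left, Equiv.swap_apply_right]
      cases h1 : γ a <;> cases h2 : γ b <;> simp [posSign, ha, hb, pow_succ] <;> simp_all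
    rw [if_neg hγ, if_neg hγ, map_sub, map_smul, signOp_basis, signOp_basis, hs]
    cases γ a <;> simp only [if_true, Bool.false_eq_true, if_false, smul_sub, inv_neg,
      smul_smul, neg_sub] <;> module
  exact LinearMap.congr_fun this x

end Sign

/-! ### The cell modules in tensor space -/

section Main

variable {k : Type*} [Field k]

theorem cellSpace_eq_map (v : kˣ) (n a b : ℕ) :
    cellSpace v n a b = (walkSpan (v : k) n a b).map (Tens.of v n).toLinearMap := by
  rw [cellSpace, walkSpan, Submodule.map_span, ← Set.range_comp]
  rfl

end Main

end TLCell

theorem mainTheorem5 {k : Type*} [Field k] (v : kˣ) (n : ℕ) (hn : qFactorial (v : k) n ≠ 0)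
    (l₁ l₂ : ℕ) (hle : l₂ ≤ l₁) (hsum : l₁ + l₂ = n) :
    ∃ (C : Submodule (TL k n (-((v : k) + (v : k)⁻¹))) (Tens v n))
      (C' : Submodule (TL k n ((v : k) + (v : k)⁻¹)) (Tens v n)),
      (C : Set (Tens v n)) = (cellSpace v n l₁ l₂ : Set (Tens v n)) ∧
      (C' : Set (Tens v n)) = (cellSpace v n l₁ l₂ : Set (Tens v n)) ∧
      (∃ φ : CellModule n (-((v : k) + (v : k)⁻¹)) (l₁ - l₂)
            ≃ₗ[TL k n (-((v : k) + (v : k)⁻¹))] C,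
        ∀ (l : LinkDiagram n) (h : l.defects = l₁ - l₂),
          ((φ (CellModule.cls (-((v : k) + (v : k)⁻¹)) l h.le) : C) : Tens v n)
            = l.vec v) ∧
      Nonempty (CellModule n ((v : k) + (v : k)⁻¹) (l₁ - l₂)
        ≃ₗ[TL k n ((v : k) + (v : k)⁻¹)] C') := by
  have hv : (v : k) ≠ 0 := v.ne_zero
  have hspan := walkSpan_eq_nestingSpan hv hn hle hsum
  have hspan' := walkSpan_eq_nestingSpan (neg_ne_zero.2 hv) (qFactorial_neg_ne_zero hv hn) hle hsum
  obtain ⟨C, hC, φ, hφ⟩ := CellModule.exists_equiv (d := l₁ - l₂)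
    (δ := -((v : k) + (v : k)⁻¹)) (fun l : LinkDiagram n => l.vec v)
    ((linearIndependent_vec (v : k) n).map' (Tens.of v n).toLinearMap (Tens.of v n).ker)
    (fun i l hl => by
      rw [LinkDiagram.vec, Tens.e_smul_of, eDot_vec hv i l hl]
      split_ifs
      · exact map_smul _ _ _
      · exact map_zero _)
  -- For `TL_n(δ)` the vectors for the parameter `-v`, for which the loop value is `δ`, are
  -- transported by `signOp`.
  obtain ⟨C', hC', φ', -⟩ := CellModule.exists_equiv (d := l₁ - l₂)
    (δ := (v : k) + (v : k)⁻¹)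
    (fun l : LinkDiagram n => Tens.of v n (signOp k n (l.nesting.2.vec (-v : k))))
    (((linearIndependent_vec (-v : k) n).map' (signOp k n)
      (LinearMap.ker_eq_bot.2
        (Function.LeftInverse.injective (g := signOp k n) signOp_signOp))).map'
        (Tens.of v n).toLinearMap (Tens.of v n).ker)
    (fun i l hl => by
      rw [Tens.e_smul_of', eDot_signOp, eDot_vec (neg_ne_zero.2 hv) i l hl, inv_neg,
        ← neg_add, neg_neg, ← map_neg, neg_neg]
      split_ifs
      · rw [map_smul, map_smul]
      · rw [map_zero, map_zero])
  refine ⟨C, C', hC.trans ?_, hC'.trans ?_, ⟨φ, hφ⟩, ⟨φ'⟩⟩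
  · rw [cellSpace_eq_map, hspan, nestingSpan_eq, Submodule.map_span, ← Set.image_comp]
    rfl
  · rw [cellSpace_eq_map, ← map_signOp_walkSpan hv, hspan', nestingSpan_eq, Submodule.map_span,
      Submodule.map_span, ← Set.image_comp, ← Set.image_comp]
    rfl
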